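/- Let $K$ be an arbitrary field. For a Lie algebra $L$ over $K$ write $L^1=L$, $L^{i+1}=[L^i,L]$. If $L\cong F/R$ with $F$ a free Lie algebra over $K$ and $R$ an ideal of $F$, the $2$-nilpotent multiplier of $L$ is $$\mathcal M^{(2)}(L)=(R\cap F^3)\,/\,[[R,F],F],$$ which up to isomorphism does not depend on the presentation. Let $A(k)$ denote the abelian Lie algebra of dimension $k$, and $H(1)$ the Heisenberg Lie algebra with basis $x,y,z$ whose only nonzero brackets of basis vectors are $[x,y]=z=-[y,x]$. **Theorem.** Let $L$ be an $n$-dimensional nilpotent Lie algebra over $K$ with $\dim L^2=m\ge 1$. Then, for every free presentation of $L$, $\mathcal M^{(2)}(L)$ is finite dimensional and $$\dim\mathcal M^{(2)}(L)\le \tfrac13(n-m)\big((n+2m-2)(n-m-1)+3(m-1)\big)+3 .$$ In particular, $$\dim\mathcal M^{(2)}(L)\le \tfrac13 n(n-1)(n-2)+3 ,$$ and equality holds in this last inequality if and only if $L\cong H(1)\oplus A(n-3)$. -/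

import Mathlib

noncomputable section

/-- The abelian Lie algebra `A(n)` of dimension `n` over `K`: the space `K ^ n` with the zero
bracket. -/
def AbelianLie (K : Type*) (n : ℕ) : Type _ := Fin n → K

namespace AbelianLie

variable {K : Type*} [Field K] {n : ℕ}

instance : AddCommGroup (AbelianLie K n) := inferInstanceAs (AddCommGroup (Fin n → K))

instance : Module K (AbelianLie K n) := inferInstanceAs (Module K (Fin n → K))

instance : LieRing (AbelianLie K n) where
  bracket _ _ := 0
  add_lie _ _ _ := (add_zero _).symm
  lie_add _ _ _ := (add_zero _).symm
  lie_self _ := rfl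
  leibniz_lie _ _ _ := (add_zero _).symm

instance : LieAlgebra K (AbelianLie K n) where
  lie_smul t _ _ := (smul_zero t).symm

end AbelianLie

/-- The Heisenberg Lie algebra `H(m)` of dimension `2 m + 1` over `K`: it has the basis
`x₁, …, xₘ, y₁, …, yₘ, z`, and the only nonzero brackets of basis vectors are
`[xᵢ, yᵢ] = z = - [yᵢ, xᵢ]`. An element is the triple of its `x`-, `y`- and `z`-coordinates. -/
def HeisenbergLie (K : Type*) (m : ℕ) : Type _ := (Fin m → K) × (Fin m → K) × K

namespace HeisenbergLie

variable {K : Type*} [Field K] {m : ℕ}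

instance : AddCommGroup (HeisenbergLie K m) :=
  inferInstanceAs (AddCommGroup ((Fin m → K) × (Fin m → K) × K))

instance : Module K (HeisenbergLie K m) :=
  inferInstanceAs (Module K ((Fin m → K) × (Fin m → K) × K))

/-- The bracket `[(a, b, c), (a', b', c')] = (0, 0, a ⬝ b' - a' ⬝ b)`. -/
instance : Bracket (HeisenbergLie K m) (HeisenbergLie K m) where
  bracket u v := ((0, 0, u.1 ⬝ᵥ v.2.1 - v.1 ⬝ᵥ u.2.1) : (Fin m → K) × (Fin m → K) × K)

instance : LieRing (HeisenbergLie K m) where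
  add_lie u v w := by
    refine Prod.ext (add_zero _).symm (Prod.ext (add_zero _).symm ?_)
    change (u.1 + v.1) ⬝ᵥ w.2.1 - w.1 ⬝ᵥ (u.2.1 + v.2.1) =
      (u.1 ⬝ᵥ w.2.1 - w.1 ⬝ᵥ u.2.1) + (v.1 ⬝ᵥ w.2.1 - w.1 ⬝ᵥ v.2.1)
    rw [add_dotProduct, dotProduct_add]
    ring
  lie_add u v w := by
    refine Prod.ext (add_zero _).symm (Prod.ext (add_zero _).symm ?_)
    change u.1 ⬝ᵥ (v.2.1 + w.2.1) - (v.1 + w.1) ⬝ᵥ u.2.1 =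
      (u.1 ⬝ᵥ v.2.1 - v.1 ⬝ᵥ u.2.1) + (u.1 ⬝ᵥ w.2.1 - w.1 ⬝ᵥ u.2.1)
    rw [add_dotProduct, dotProduct_add]
    ring
  lie_self u := Prod.ext rfl (Prod.ext rfl (sub_self _))
  leibniz_lie u v w := by
    refine Prod.ext (add_zero _).symm (Prod.ext (add_zero _).symm ?_)
    change u.1 ⬝ᵥ (0 : Fin m → K) - (0 : Fin m → K) ⬝ᵥ u.2.1 =
      ((0 : Fin m → K) ⬝ᵥ w.2.1 - w.1 ⬝ᵥ (0 : Fin m → K)) +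
        (v.1 ⬝ᵥ (0 : Fin m → K) - (0 : Fin m → K) ⬝ᵥ v.2.1)
    simp only [dotProduct_zero, zero_dotProduct, sub_self, add_zero]

instance : LieAlgebra K (HeisenbergLie K m) where
  lie_smul t u v := by
    refine Prod.ext (smul_zero t).symm (Prod.ext (smul_zero t).symm ?_)
    change u.1 ⬝ᵥ (t • v.2.1) - (t • v.1) ⬝ᵥ u.2.1 = t • (u.1 ⬝ᵥ v.2.1 - v.1 ⬝ᵥ u.2.1)
    rw [dotProduct_smul, smul_dotProduct, smul_sub]

end HeisenbergLie

section Multiplier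

variable {K F L : Type*} [Field K] [LieRing F] [LieAlgebra K F] [LieRing L] [LieAlgebra K L]

/-- For a surjection `π : F → L` with kernel `R`, the ideal `R ∩ F ^ (c + 1)` of `F`, where
`F ^ (c + 1) = γ_{c+1}(F)` is a term of the lower central series (`F ^ 1 = F`). -/
def multiplierNum (c : ℕ) (π : F →ₗ⁅K⁆ L) : LieIdeal K F :=
  π.ker ⊓ LieModule.lowerCentralSeries K F F c

/-- For a surjection `π : F → L` with kernel `R`, the ideal `[R, F] ^ (c + 1) = [R, F, …, F]`
(with `c` copies of `F`) of `F`; that is `[[R, F], F]` for `c = 2`. -/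
def multiplierDen (c : ℕ) (π : F →ₗ⁅K⁆ L) : LieIdeal K F :=
  LieSubmodule.lcs c π.ker

theorem multiplierDen_le_multiplierNum (c : ℕ) (π : F →ₗ⁅K⁆ L) :
    multiplierDen c π ≤ multiplierNum c π := by
  refine le_inf (LieSubmodule.lcs_le_self c _) ?_
  induction c with
  | zero => exact le_top
  | succ k ih =>
    rw [multiplierDen, LieSubmodule.lcs_succ, LieModule.lowerCentralSeries_succ]
    exact LieSubmodule.mono_lie_right _ ih

/-- The `c`-nilpotent multiplier `M^(c)(L) = (R ∩ F ^ (c + 1)) / [R, F] ^ (c + 1)` of `L`, as a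
vector space over `K`, computed from a presentation `0 → R → F → L → 0`; here `π : F → L` is
meant to be surjective and `F` to be a free Lie algebra. -/
abbrev nilpotentMultiplier (c : ℕ) (π : F →ₗ⁅K⁆ L) : Type _ :=
  (multiplierNum c π).toSubmodule ⧸
    (multiplierDen c π).toSubmodule.submoduleOf (multiplierNum c π).toSubmodule

end Multiplier

end

/-!
The proof compares `[[R, F], F]` with `F ^ 3` along a chain of ideals of `F`, where `R` is the kernel
of the presentation `π : F → L`. Let `d = n - m`, the dimension of `L / L ^ 2`, let `S = π⁻¹(L ^ 2)`,
and let `R' = π⁻¹(I)` for an ideal `I` that is a hyperplane in `L ^ 2` and contains `L ^ 3`. The upper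
bound, which does not use that `F` is free, is the sum of three counts:

* `F ^ 3` is spanned modulo `[[S, F], F]` by the `(d ^ 3 - d) / 3` basic commutators of weight three
  in lifts of a basis of `L / L ^ 2` (`generatedMod_lowerCentralSeries_two`);
* `[[S, F], F]` is spanned modulo `[[R', F], F]` by three elements, because for a suitable `s = [a, b]`
  the form `(x, y) ↦ [y, [x, s]]` is symmetric and factors through the plane of `a` and `b`, by the
  Jacobi identity (`generatedMod_lcs_two_of_line`);
* adding one dimension at a time between `R` and `R'`, by elements central modulo the previous ideal,
  costs at most `d ^ 2` each time (`generatedMod_lcs_two_of_insert`), so `(m - 1) d ^ 2` in total.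

The sum `(d ^ 3 - d) / 3 + 3 + (m - 1) d ^ 2` is the first bound. With `n` fixed it is strictly largest
for `m = 1`, where it is the second bound. So equality in the second bound forces `L ^ 2` to be a line.
If the bracket, as an alternating form on `L / L ^ 2`, has rank at least four, then two orthogonal
hyperbolic pairs annihilate each other, `[[S, F], F] = [[R, F], F]`, and the summand `3` disappears
(`lcs_two_le_of_line_of_commute`). So the rank is two and `L ≅ H(1) ⊕ A(n - 3)`
(`nonempty_equiv_or_exists_commute`).

Conversely, for `L ≅ H(1) ⊕ A(n - 3)` the generators above have to be shown independent modulo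
`[[R, F], F]`, for an arbitrary free presentation. This is where freeness enters: a linear map from
`L` to strictly upper triangular matrices determines a homomorphism on `F`, and if the linear map
respects brackets up to the `k`-th diagonal, the homomorphism kills `[[R, F], F]` as soon as the
matrices have size `k + 2` (`liftAlong_eq_zero_of_mem`). The corner entries of such homomorphisms read
off coefficients of words, and suitable words of length three and four are dual, up to sign, to the
basic commutators (`wordFunctional_basicTriple`, `quarticFunctional_quarticCommutator`). No step
divides by an integer, so the characteristic of `K` plays no role.
-/

noncomputable section

/-! ### Finitely generated relative quotients -/

section GeneratedMod

variable {K V : Type*} [Field K] [AddCommGroup V] [Module K V]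

/-- `Q` is contained in the sum of `P` and a subspace spanned by at most `k` vectors; equivalently,
`(P + Q) / P` has dimension at most `k`. No inclusion between `P` and `Q` is required. -/
def GeneratedMod (k : ℕ) (P Q : Submodule K V) : Prop :=
  ∃ t : Finset V, t.card ≤ k ∧ Q ≤ P ⊔ Submodule.span K (t : Set V)

theorem GeneratedMod.of_le {k : ℕ} {P Q : Submodule K V} (h : Q ≤ P) : GeneratedMod k P Q :=
  ⟨∅, by simp, h.trans le_sup_left⟩

theorem GeneratedMod.mono {k l : ℕ} {P Q Q' : Submodule K V} (h : GeneratedMod k P Q)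
    (hkl : k ≤ l) (hQ : Q' ≤ Q) : GeneratedMod l P Q' := by
  obtain ⟨t, ht, h⟩ := h
  exact ⟨t, ht.trans hkl, hQ.trans h⟩

theorem GeneratedMod.trans {k l : ℕ} {P Q T : Submodule K V} (h₁ : GeneratedMod k P Q)
    (h₂ : GeneratedMod l Q T) : GeneratedMod (l + k) P T := by
  classical
  obtain ⟨t, ht, h₁⟩ := h₁
  obtain ⟨u, hu, h₂⟩ := h₂
  refine ⟨u ∪ t, (Finset.card_union_le _ _).trans (add_le_add hu ht), h₂.trans ?_⟩
  rw [Finset.coe_union, Submodule.span_union]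
  refine sup_le (h₁.trans (sup_le_sup_left le_sup_right _)) (le_sup_left.trans le_sup_right)

theorem GeneratedMod.of_family {ι : Type*} [Fintype ι] {P Q : Submodule K V} (v : ι → V)
    (h : Q ≤ P ⊔ Submodule.span K (Set.range v)) : GeneratedMod (Fintype.card ι) P Q := by
  classical
  refine ⟨Finset.univ.image v, Finset.card_image_le, ?_⟩
  simpa using h

theorem GeneratedMod.finite_and_finrank_le {k : ℕ} {P Q : Submodule K V}
    (h : GeneratedMod k P Q) :
    Module.Finite K (Q ⧸ P.submoduleOf Q) ∧ Module.finrank K (Q ⧸ P.submoduleOf Q) ≤ k := by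
  classical
  obtain ⟨t, ht, h⟩ := h
  let f : (Q ⧸ P.submoduleOf Q) →ₗ[K] V ⧸ P := (P.submoduleOf Q).mapQ P Q.subtype le_rfl
  have hf : Function.Injective f := by
    rw [← LinearMap.ker_eq_bot, LinearMap.ker_eq_bot']
    intro x
    induction x using Submodule.Quotient.induction_on with
    | H x =>
      intro hx
      exact (Submodule.Quotient.mk_eq_zero _).2 ((Submodule.Quotient.mk_eq_zero P).1 hx)
  let T : Submodule K (V ⧸ P) := Submodule.span K ((t.image P.mkQ : Finset (V ⧸ P)) : Set (V ⧸ P))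
  have hT : ∀ x, f x ∈ T := by
    intro x
    induction x using Submodule.Quotient.induction_on with
    | H x =>
      obtain ⟨p, hp, q, hq, hpq⟩ := Submodule.mem_sup.1 (h x.2)
      have : f (Submodule.Quotient.mk x) = P.mkQ q := by
        have hp0 : P.mkQ p = 0 := (Submodule.Quotient.mk_eq_zero P).2 hp
        change P.mkQ x = _
        rw [← hpq, map_add, hp0, zero_add]
      rw [this]
      have hm := Submodule.mem_map_of_mem (f := P.mkQ) hq
      rw [Submodule.map_span] at hm
      simpa [T] using hm
  have hfin : Module.Finite K T := Module.Finite.span_finset K _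
  let g : (Q ⧸ P.submoduleOf Q) →ₗ[K] T := f.codRestrict T hT
  have hg : Function.Injective g := fun x y hxy => hf (congrArg Subtype.val hxy)
  refine ⟨Module.Finite.of_injective g hg, ?_⟩
  calc _ ≤ Module.finrank K T := LinearMap.finrank_le_finrank_of_injective hg
    _ ≤ (t.image P.mkQ).card := finrank_span_finset_le_card _
    _ ≤ t.card := Finset.card_image_le
    _ ≤ k := ht

/-- Linear functionals that vanish on `P` and are jointly surjective on `Q` bound the dimension of
`Q / P` from below. -/
theorem card_le_finrank_of_functionals {ι : Type*} [Fintype ι] {P Q : Submodule K V}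
    [Module.Finite K (Q ⧸ P.submoduleOf Q)] (f : V →ₗ[K] ι → K)
    (hP : ∀ x ∈ P, f x = 0) (hQ : ∀ v, ∃ x ∈ Q, f x = v) :
    Fintype.card ι ≤ Module.finrank K (Q ⧸ P.submoduleOf Q) := by
  let g : (Q ⧸ P.submoduleOf Q) →ₗ[K] ι → K :=
    (P.submoduleOf Q).liftQ (f.comp Q.subtype) fun x hx => hP _ hx
  have hg : Function.Surjective g := by
    intro v
    obtain ⟨x, hx, hv⟩ := hQ v
    exact ⟨Submodule.Quotient.mk ⟨x, hx⟩, hv⟩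
  simpa using LinearMap.finrank_le_finrank_of_surjective hg

end GeneratedMod

/-! ### Triple brackets -/

section TripleBracket

variable {K F : Type*} [Field K] [LieRing F] [LieAlgebra K F]

theorem lie_mem_lcs_two {R : LieIdeal K F} {r : F} (hr : r ∈ R) (x y : F) :
    ⁅y, ⁅x, r⁆⁆ ∈ LieSubmodule.lcs 2 R := by
  rw [LieSubmodule.lcs_succ, LieSubmodule.lcs_succ, LieSubmodule.lcs_zero]
  exact LieSubmodule.lie_mem_lie (LieSubmodule.mem_top _)
    (LieSubmodule.lie_mem_lie (LieSubmodule.mem_top _) hr)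

theorem lie_lie_mem_lcs_two {R : LieIdeal K F} {r : F} (hr : r ∈ R) (x y : F) :
    ⁅⁅x, y⁆, r⁆ ∈ LieSubmodule.lcs 2 R := by
  rw [lie_lie]
  exact sub_mem (lie_mem_lcs_two hr _ _) (lie_mem_lcs_two hr _ _)

theorem lie_lie_mem_lcs_two' {R : LieIdeal K F} {r : F} (hr : r ∈ R) (x y : F) :
    ⁅r, ⁅x, y⁆⁆ ∈ LieSubmodule.lcs 2 R := by
  rw [← lie_skew]
  exact neg_mem (lie_lie_mem_lcs_two hr _ _)

theorem lie_lie_left_mem_lcs_two {R : LieIdeal K F} {r : F} (hr : r ∈ R) (x y : F) :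
    ⁅y, ⁅r, x⁆⁆ ∈ LieSubmodule.lcs 2 R := by
  rw [← lie_skew r x, lie_neg]
  exact neg_mem (lie_mem_lcs_two hr _ _)

theorem lcs_two_le {R : LieIdeal K F} {P : Submodule K F}
    (h : ∀ x y : F, ∀ r ∈ R, ⁅y, ⁅x, r⁆⁆ ∈ P) : (LieSubmodule.lcs 2 R).toSubmodule ≤ P := by
  rw [LieSubmodule.lcs_succ, LieSubmodule.lieIdeal_oper_eq_linear_span', Submodule.span_le]
  rintro _ ⟨y, -, s, hs, rfl⟩
  rw [LieSubmodule.lcs_succ, LieSubmodule.lcs_zero] at hs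
  have : ⁅(⊤ : LieIdeal K F), R⁆.toSubmodule ≤ P.comap (LieAlgebra.ad K F y) := by
    rw [LieSubmodule.lieIdeal_oper_eq_linear_span', Submodule.span_le]
    rintro _ ⟨x, -, r, hr, rfl⟩
    exact h x y r hr
  exact this hs

theorem lie_top_le {R : LieIdeal K F} {P : Submodule K F}
    (h : ∀ x : F, ∀ r ∈ R, ⁅x, r⁆ ∈ P) : ⁅(⊤ : LieIdeal K F), R⁆.toSubmodule ≤ P := by
  rw [LieSubmodule.lieIdeal_oper_eq_linear_span', Submodule.span_le]
  rintro _ ⟨x, -, r, hr, rfl⟩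
  exact h x r hr

/-- Enlarging `R'` by one element `s` with `[F, s] ⊆ R'` enlarges `[[R', F], F]` by at most `d ^ 2`
dimensions: modulo `[[R', F], F]`, the element `[y, [x, s]]` depends only on `x` and `y` modulo
`R' + F ^ 2`. Here the `uᵢ` span `F` modulo `W`. -/
theorem generatedMod_lcs_two_of_insert {d : ℕ} {R' R : LieIdeal K F} (s : F)
    (hs : ∀ r ∈ R, ∃ c : K, r - c • s ∈ R') (hc : ∀ x : F, ⁅x, s⁆ ∈ R')
    (u : Fin d → F) {W : Submodule K F}
    (hW : W ≤ R'.toSubmodule ⊔ ⁅(⊤ : LieIdeal K F), (⊤ : LieIdeal K F)⁆.toSubmodule)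
    (hu : ∀ x, ∃ y ∈ Submodule.span K (Set.range u), x - y ∈ W) :
    GeneratedMod (d * d) (LieSubmodule.lcs 2 R').toSubmodule
      (LieSubmodule.lcs 2 R).toSubmodule := by
  let D := (LieSubmodule.lcs 2 R').toSubmodule
  let P := D ⊔ Submodule.span K (Set.range fun p : Fin d × Fin d => ⁅u p.1, ⁅u p.2, s⁆⁆)
  have hx : ∀ x ∈ W, ∀ y : F, ⁅y, ⁅x, s⁆⁆ ∈ D := by
    intro x hx y
    have : W ≤ D.comap (LieAlgebra.ad K F y ∘ₗ
        (LieAlgebra.ad K F : F →ₗ[K] Module.End K F).flip s) := by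
      refine hW.trans (sup_le ?_ (lie_top_le ?_))
      · intro r hr
        exact lie_lie_left_mem_lcs_two hr _ _
      · intro a b _
        change ⁅y, ⁅⁅a, b⁆, s⁆⁆ ∈ D
        rw [lie_lie, lie_sub]
        exact sub_mem (lie_mem_lcs_two (hc _) _ _) (lie_mem_lcs_two (hc _) _ _)
    exact this hx
  have hy : ∀ y ∈ W, ∀ x : F, ⁅y, ⁅x, s⁆⁆ ∈ D := by
    intro y hy x
    have : W ≤ D.comap
        ((LieAlgebra.ad K F : F →ₗ[K] Module.End K F).flip ⁅x, s⁆) := by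
      refine hW.trans (sup_le ?_ (lie_top_le ?_))
      · intro r hr
        exact lie_lie_mem_lcs_two' hr _ _
      · intro a b _
        exact lie_lie_mem_lcs_two (hc x) a b
    exact this hy
  have hspan : ∀ x ∈ Submodule.span K (Set.range u), ∀ y ∈ Submodule.span K (Set.range u),
      ⁅y, ⁅x, s⁆⁆ ∈ P := by
    intro x hx y hy
    induction hx, hy using Submodule.span_induction₂ with
    | mem_mem x y hx hy =>
      obtain ⟨i, rfl⟩ := hx
      obtain ⟨j, rfl⟩ := hy
      exact Submodule.mem_sup_right (Submodule.subset_span ⟨(j, i), rfl⟩)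
    | zero_left => simp
    | zero_right => simp
    | add_left x y z _ _ _ h₁ h₂ => rw [add_lie, lie_add]; exact add_mem h₁ h₂
    | add_right x y z _ _ _ h₁ h₂ => rw [add_lie]; exact add_mem h₁ h₂
    | smul_left r x y _ _ h => rw [smul_lie, lie_smul]; exact P.smul_mem r h
    | smul_right r x y _ _ h => rw [smul_lie]; exact P.smul_mem r h
  have hDP : D ≤ P := le_sup_left
  have key : ∀ x y : F, ⁅y, ⁅x, s⁆⁆ ∈ P := by
    intro x y
    obtain ⟨x', hx', hxW⟩ := hu x
    obtain ⟨y', hy', hyW⟩ := hu y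
    have e : ⁅y, ⁅x, s⁆⁆ = ⁅y', ⁅x', s⁆⁆ + ⁅y, ⁅x - x', s⁆⁆ + ⁅y - y', ⁅x', s⁆⁆ := by
      simp only [sub_lie, lie_sub]; abel
    rw [e]
    exact add_mem (add_mem (hspan _ hx' _ hy') (hDP (hx _ hxW _))) (hDP (hy _ hyW _))
  have := GeneratedMod.of_family (P := D) (Q := (LieSubmodule.lcs 2 R).toSubmodule)
    (fun p : Fin d × Fin d => ⁅u p.1, ⁅u p.2, s⁆⁆) (lcs_two_le ?_)
  · rwa [Fintype.card_prod, Fintype.card_fin] at this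
  · intro x y r hr
    obtain ⟨c, hc'⟩ := hs r hr
    have e : ⁅y, ⁅x, r⁆⁆ = ⁅y, ⁅x, r - c • s⁆⁆ + c • ⁅y, ⁅x, s⁆⁆ := by
      simp only [lie_sub, lie_smul]; abel
    rw [e]
    exact add_mem (hDP (lie_mem_lcs_two hc' _ _)) (P.smul_mem c (key x y))

end TripleBracket

/-! ### The third term of the lower central series modulo `[[S, F], F]` -/

section CubicTerm

/-- The index set of the basic commutators of weight three on `d` letters: triples `(i, j, k)` with
`j < i` and `j ≤ k`, standing for `[[e_i, e_j], e_k]`. -/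
abbrev BasicTriple (d : ℕ) : Type :=
  {p : Fin d × Fin d × Fin d // p.2.1 < p.1 ∧ p.2.1 ≤ p.2.2}

theorem three_mul_card_basicTriple (d : ℕ) :
    3 * (Fintype.card (BasicTriple d) : ℤ) = (d : ℤ) ^ 3 - d := by
  have h : Fintype.card (BasicTriple d) = ∑ j : Fin d, (d - 1 - j) * (d - j) := by
    rw [Fintype.card_congr (β := Σ j : Fin d, Finset.Ioi j × Finset.Ici j)]
    · rw [Fintype.card_sigma]
      refine Finset.sum_congr rfl fun j _ => ?_
      rw [Fintype.card_prod, Fintype.card_coe, Fintype.card_coe, Fin.card_Ioi, Fin.card_Ici]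
    · exact
        { toFun p := ⟨p.1.2.1, ⟨p.1.1, Finset.mem_Ioi.2 p.2.1⟩, ⟨p.1.2.2, Finset.mem_Ici.2 p.2.2⟩⟩
          invFun q := ⟨(q.2.1.1, q.1, q.2.2.1),
            Finset.mem_Ioi.1 q.2.1.2, Finset.mem_Ici.1 q.2.2.2⟩
          left_inv _ := rfl
          right_inv _ := rfl }
  have h' : ∑ j : Fin d, (d - 1 - j) * (d - j) = ∑ t ∈ Finset.range d, t * (t + 1) := by
    rw [Finset.sum_range, ← Equiv.sum_comp Fin.revPerm]
    refine Finset.sum_congr rfl fun j _ => ?_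
    rw [Fin.revPerm_apply, Fin.val_rev]
    congr 1 <;> omega
  rw [h, h']
  clear h h'
  push_cast
  induction d with
  | zero => simp
  | succ n ih => rw [Finset.sum_range_succ, mul_add, ih]; push_cast; ring

variable {K F : Type*} [Field K] [LieRing F] [LieAlgebra K F]

/-- If `F` is spanned by `u₁, …, u_d` modulo an ideal `S`, then `F ^ 3` is spanned
by the basic commutators of weight three in the `uᵢ`, modulo `[[S, F], F]`. -/
theorem generatedMod_lowerCentralSeries_two {d : ℕ} {S : LieIdeal K F}
    (u : Fin d → F) (hu : ∀ x, ∃ y ∈ Submodule.span K (Set.range u), x - y ∈ S) :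
    GeneratedMod (Fintype.card (BasicTriple d)) (LieSubmodule.lcs 2 S).toSubmodule
      (LieModule.lowerCentralSeries K F F 2).toSubmodule := by
  let D := (LieSubmodule.lcs 2 S).toSubmodule
  let v : BasicTriple d → F := fun p => ⁅⁅u p.1.1, u p.1.2.1⁆, u p.1.2.2⁆
  let P := D ⊔ Submodule.span K (Set.range v)
  have hDP : D ≤ P := le_sup_left
  have hE : ∀ i j k, j < i → j ≤ k → ⁅⁅u i, u j⁆, u k⁆ ∈ P := fun i j k h₁ h₂ =>
    Submodule.mem_sup_right (Submodule.subset_span ⟨⟨(i, j, k), h₁, h₂⟩, rfl⟩)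
  -- The Jacobi identity rewrites `[[u_i, u_j], u_k]` with `k < j < i` by basic commutators.
  have hE' : ∀ i j k, j < i → ⁅⁅u i, u j⁆, u k⁆ ∈ P := by
    intro i j k hij
    rcases le_or_gt j k with hjk | hjk
    · exact hE i j k hij hjk
    · have e : ⁅⁅u i, u j⁆, u k⁆ = ⁅⁅u i, u k⁆, u j⁆ - ⁅⁅u j, u k⁆, u i⁆ := by
        rw [lie_lie, ← lie_skew (u j) ⁅u i, u k⁆, ← lie_skew (u i) ⁅u j, u k⁆]
        abel
      rw [e]
      exact sub_mem (hE i k j (hjk.trans hij) hjk.le) (hE j k i hjk (hjk.trans hij).le)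
  have hE'' : ∀ i j k, ⁅⁅u i, u j⁆, u k⁆ ∈ P := by
    intro i j k
    rcases lt_trichotomy i j with h | rfl | h
    · rw [← lie_skew (u i), neg_lie]
      exact neg_mem (hE' j i k h)
    · simp
    · exact hE' i j k h
  have h₁ : ∀ i j, ∀ x, ⁅⁅u i, u j⁆, x⁆ ∈ P := by
    intro i j x
    obtain ⟨x', hx', hx⟩ := hu x
    have e : ⁅⁅u i, u j⁆, x⁆ = ⁅⁅u i, u j⁆, x'⁆ + ⁅⁅u i, u j⁆, x - x'⁆ := by
      rw [← lie_add, add_sub_cancel]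
    rw [e]
    refine add_mem ?_ (hDP (lie_lie_mem_lcs_two hx _ _))
    have : Submodule.span K (Set.range u) ≤
        P.comap (LieAlgebra.ad K F ⁅u i, u j⁆) := by
      rw [Submodule.span_le]
      rintro _ ⟨k, rfl⟩
      exact hE'' i j k
    exact this hx'
  have h₂ : ∀ x y z : F, ⁅x, ⁅y, z⁆⁆ ∈ P := by
    intro x y z
    obtain ⟨y', hy', hy⟩ := hu y
    obtain ⟨z', hz', hz⟩ := hu z
    have e : ⁅x, ⁅y, z⁆⁆ = -⁅⁅y', z'⁆, x⁆ + ⁅x, ⁅y - y', z⁆⁆ + ⁅x, ⁅y', z - z'⁆⁆ := by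
      rw [lie_skew]; simp only [sub_lie, lie_sub]; abel
    rw [e]
    refine add_mem (add_mem (neg_mem ?_) (hDP (lie_lie_left_mem_lcs_two hy _ _)))
      (hDP (lie_mem_lcs_two hz _ _))
    clear hy hz e
    induction hy', hz' using Submodule.span_induction₂ with
    | mem_mem a b ha hb =>
      obtain ⟨i, rfl⟩ := ha
      obtain ⟨j, rfl⟩ := hb
      exact h₁ i j x
    | zero_left => simp
    | zero_right => simp
    | add_left a b c _ _ _ h₁ h₂ => rw [add_lie, add_lie]; exact add_mem h₁ h₂
    | add_right a b c _ _ _ h₁ h₂ => rw [lie_add, add_lie]; exact add_mem h₁ h₂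
    | smul_left r a b _ _ h => rw [smul_lie, smul_lie]; exact P.smul_mem r h
    | smul_right r a b _ _ h => rw [lie_smul, smul_lie]; exact P.smul_mem r h
  exact GeneratedMod.of_family v (lcs_two_le fun x y r _ => h₂ y x r)

end CubicTerm

/-! ### One-dimensional derived algebra -/

section DerivedLine

variable {K F : Type*} [Field K] [LieRing F] [LieAlgebra K F]

theorem lie_lie_mem_of_commute {R : LieIdeal K F} {a b c : F} (ha : ⁅a, c⁆ ∈ R) (hb : ⁅b, c⁆ ∈ R) :
    ⁅c, ⁅a, b⁆⁆ ∈ ⁅(⊤ : LieIdeal K F), R⁆ := by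
  have e : ⁅c, ⁅a, b⁆⁆ = ⁅b, ⁅a, c⁆⁆ - ⁅a, ⁅b, c⁆⁆ := by
    rw [← lie_skew, lie_lie]; abel
  rw [e]
  exact sub_mem (LieSubmodule.lie_mem_lie (LieSubmodule.mem_top _) ha)
    (LieSubmodule.lie_mem_lie (LieSubmodule.mem_top _) hb)

theorem lie_mem_lcs_two_of_mem {R : LieIdeal K F} {r : F}
    (hr : r ∈ ⁅(⊤ : LieIdeal K F), R⁆) (y : F) : ⁅y, r⁆ ∈ LieSubmodule.lcs 2 R := by
  rw [LieSubmodule.lcs_succ, LieSubmodule.lcs_succ, LieSubmodule.lcs_zero]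
  exact LieSubmodule.lie_mem_lie (LieSubmodule.mem_top _) hr

/-- Each element of `F` is a combination of `a`, `b` and an element
that commutes with both modulo `R`, provided that `F ^ 2` is spanned by `[a, b]` modulo `R`. -/
theorem exists_commute_sub {R : LieIdeal K F} {a b : F}
    (hline : ∀ x y : F, ∃ t : K, ⁅x, y⁆ - t • ⁅a, b⁆ ∈ R) (x : F) :
    ∃ p q : K, ⁅a, x - p • a - q • b⁆ ∈ R ∧ ⁅b, x - p • a - q • b⁆ ∈ R := by
  obtain ⟨q, hq⟩ := hline a x
  obtain ⟨p, hp⟩ := hline x b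
  refine ⟨p, q, ?_, ?_⟩
  · simpa [lie_sub] using hq
  · have e : ⁅b, x - p • a - q • b⁆ = -(⁅x, b⁆ - p • ⁅a, b⁆) := by
      rw [← lie_skew x b, ← lie_skew a b]
      simp only [lie_sub, lie_smul, lie_self, smul_neg]
      module
    rw [e]
    exact neg_mem hp

/-- If `F ^ 2 ≤ S` and `S` is spanned by `s = [a, b]` modulo `R`, then `[[S, F], F]` is spanned modulo
`[[R, F], F]` by three elements: the form `(x, y) ↦ [y, [x, s]]` is symmetric, since `[s, s] = 0`, and
factors through the plane spanned by `a` and `b`. -/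
theorem generatedMod_lcs_two_of_line {R S : LieIdeal K F} {a b : F}
    (hS : ∀ x ∈ S, ∃ t : K, x - t • ⁅a, b⁆ ∈ R) (hF : ∀ x y : F, ⁅x, y⁆ ∈ S) :
    GeneratedMod 3 (LieSubmodule.lcs 2 R).toSubmodule (LieSubmodule.lcs 2 S).toSubmodule := by
  have hline : ∀ x y : F, ∃ t : K, ⁅x, y⁆ - t • ⁅a, b⁆ ∈ R := fun x y => hS _ (hF x y)
  set s := ⁅a, b⁆ with hs
  let D := (LieSubmodule.lcs 2 R).toSubmodule
  let v : Fin 3 → F := ![⁅a, ⁅a, s⁆⁆, ⁅a, ⁅b, s⁆⁆, ⁅b, ⁅b, s⁆⁆]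
  let P := D ⊔ Submodule.span K (Set.range v)
  have hDP : D ≤ P := le_sup_left
  have hv : ∀ i, v i ∈ P := fun i => Submodule.mem_sup_right (Submodule.subset_span ⟨i, rfl⟩)
  have haa : ⁅a, ⁅a, s⁆⁆ ∈ P := hv 0
  have hab : ⁅a, ⁅b, s⁆⁆ ∈ P := hv 1
  have hbb : ⁅b, ⁅b, s⁆⁆ ∈ P := hv 2
  have hba : ⁅b, ⁅a, s⁆⁆ ∈ P := by
    have : ⁅b, ⁅a, s⁆⁆ = ⁅a, ⁅b, s⁆⁆ := by
      have h := lie_lie a b s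
      rw [← hs, lie_self] at h
      exact (sub_eq_zero.1 h.symm).symm
    rwa [this]
  have hcol : ∀ x : F, ⁅a, s⁆ = x ∨ ⁅b, s⁆ = x → ⁅a, x⁆ ∈ P → ⁅b, x⁆ ∈ P → ∀ y : F, ⁅y, x⁆ ∈ P := by
    intro x hx hax hbx y
    obtain ⟨p, q, hp, hq⟩ := exists_commute_sub hline y
    set c := y - p • a - q • b with hc
    have e : ⁅y, x⁆ = ⁅c, x⁆ + p • ⁅a, x⁆ + q • ⁅b, x⁆ := by
      rw [hc]; simp only [sub_lie, smul_lie]; abel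
    rw [e]
    refine add_mem (add_mem (hDP ?_) (P.smul_mem _ hax)) (P.smul_mem _ hbx)
    rcases hx with rfl | rfl
    · rw [leibniz_lie]
      refine add_mem ?_ (lie_mem_lcs_two_of_mem (lie_lie_mem_of_commute hp hq) _)
      rw [← lie_skew c a, neg_lie]
      exact neg_mem (lie_lie_mem_lcs_two' hp _ _)
    · rw [leibniz_lie]
      refine add_mem ?_ (lie_mem_lcs_two_of_mem (lie_lie_mem_of_commute hp hq) _)
      rw [← lie_skew c b, neg_lie]
      exact neg_mem (lie_lie_mem_lcs_two' hq _ _)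
  have key : ∀ x y : F, ⁅y, ⁅x, s⁆⁆ ∈ P := by
    intro x y
    obtain ⟨p, q, hp, hq⟩ := exists_commute_sub hline x
    set c := x - p • a - q • b with hc
    have e : ⁅y, ⁅x, s⁆⁆ = ⁅y, ⁅c, s⁆⁆ + p • ⁅y, ⁅a, s⁆⁆ + q • ⁅y, ⁅b, s⁆⁆ := by
      rw [hc]; simp only [sub_lie, smul_lie, lie_sub, lie_smul]; abel
    rw [e]
    exact add_mem (add_mem (hDP (lie_mem_lcs_two_of_mem (lie_lie_mem_of_commute hp hq) _))
      (P.smul_mem _ (hcol _ (.inl rfl) haa hba y))) (P.smul_mem _ (hcol _ (.inr rfl) hab hbb y))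
  refine GeneratedMod.of_family v (lcs_two_le fun x y r hr => ?_)
  obtain ⟨t, ht⟩ := hS r hr
  have e : ⁅y, ⁅x, r⁆⁆ = ⁅y, ⁅x, r - t • s⁆⁆ + t • ⁅y, ⁅x, s⁆⁆ := by
    simp only [lie_sub, lie_smul]; abel
  rw [e]
  exact add_mem (hDP (lie_mem_lcs_two ht _ _)) (P.smul_mem t (key x y))

/-- If moreover the alternating form on `F` induced by the bracket has rank at least four, then
`[[S, F], F] = [[R, F], F]`: two orthogonal hyperbolic pairs kill each other. -/
theorem lcs_two_le_of_line_of_commute {R S : LieIdeal K F} {a b c e : F}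
    (hS : ∀ x ∈ S, ∃ t : K, x - t • ⁅a, b⁆ ∈ R) (hF : ∀ x y : F, ⁅x, y⁆ ∈ S)
    (hac : ⁅a, c⁆ ∈ R) (hbc : ⁅b, c⁆ ∈ R) (hae : ⁅a, e⁆ ∈ R) (hbe : ⁅b, e⁆ ∈ R)
    (hce : ⁅c, e⁆ ∉ R) :
    (LieSubmodule.lcs 2 S).toSubmodule ≤ (LieSubmodule.lcs 2 R).toSubmodule := by
  have hline : ∀ x y : F, ∃ t : K, ⁅x, y⁆ - t • ⁅a, b⁆ ∈ R := fun x y => hS _ (hF x y)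
  set s := ⁅a, b⁆ with hs
  have hswap : ∀ x y : F, ⁅x, y⁆ ∈ R → ⁅y, x⁆ ∈ R := fun x y h => by
    rw [← lie_skew]; exact neg_mem h
  obtain ⟨t, ht⟩ := hline c e
  have ht0 : t ≠ 0 := by
    rintro rfl
    exact hce (by simpa using ht)
  -- `s` is proportional to `[c, e]` modulo `R`, and `a`, `b` commute with `c` and `e`.
  have hpair : ∀ x : F, ⁅c, x⁆ ∈ R → ⁅e, x⁆ ∈ R → ⁅x, s⁆ ∈ ⁅(⊤ : LieIdeal K F), R⁆ := by
    intro x hcx hex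
    have e' : ⁅x, s⁆ = t⁻¹ • (⁅x, ⁅c, e⁆⁆ - ⁅x, ⁅c, e⁆ - t • s⁆) := by
      rw [lie_sub, sub_sub_cancel, lie_smul, inv_smul_smul₀ ht0]
    rw [e']
    exact SMulMemClass.smul_mem _ (sub_mem (lie_lie_mem_of_commute hcx hex)
      (LieSubmodule.lie_mem_lie (LieSubmodule.mem_top _) ht))
  have key : ∀ x : F, ⁅x, s⁆ ∈ ⁅(⊤ : LieIdeal K F), R⁆ := by
    intro x
    obtain ⟨p, q, hp, hq⟩ := exists_commute_sub hline x
    set c' := x - p • a - q • b with hc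
    have e' : ⁅x, s⁆ = ⁅c', s⁆ + p • ⁅a, s⁆ + q • ⁅b, s⁆ := by
      rw [hc]; simp only [sub_lie, smul_lie]; abel
    rw [e']
    exact add_mem (add_mem (lie_lie_mem_of_commute hp hq)
      (SMulMemClass.smul_mem _ (hpair a (hswap _ _ hac) (hswap _ _ hae))))
      (SMulMemClass.smul_mem _ (hpair b (hswap _ _ hbc) (hswap _ _ hbe)))
  refine lcs_two_le fun x y r hr => ?_
  obtain ⟨t, ht⟩ := hS r hr
  have e : ⁅y, ⁅x, r⁆⁆ = ⁅y, ⁅x, r - t • s⁆⁆ + t • ⁅y, ⁅x, s⁆⁆ := by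
    simp only [lie_sub, lie_smul]; abel
  rw [e]
  exact add_mem (lie_mem_lcs_two ht _ _)
    (SMulMemClass.smul_mem _ (lie_mem_lcs_two_of_mem (key x) _))

end DerivedLine

/-! ### Detecting elements of the multiplier by matrices -/

section Detection

attribute [local instance] LieRing.ofAssociativeRing

variable {K L : Type*} [Field K] [LieRing L] [LieAlgebra K L]

/-- The matrices supported on the diagonals `j ≥ i + k`; for `k = 1` these are the strictly upper
triangular ones, and for `k = N` only the zero matrix. -/
def diagonalFiltration (K : Type*) [Field K] (N k : ℕ) : Submodule K (Matrix (Fin N) (Fin N) K) where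
  carrier := {M | ∀ i j : Fin N, (j : ℕ) < i + k → M i j = 0}
  add_mem' hA hB i j h := by rw [Matrix.add_apply, hA i j h, hB i j h, add_zero]
  zero_mem' _ _ _ := rfl
  smul_mem' c A hA i j h := by rw [Matrix.smul_apply, hA i j h, smul_zero]

theorem diagonalFiltration_anti {N k l : ℕ} (h : k ≤ l) :
    diagonalFiltration K N l ≤ diagonalFiltration K N k :=
  fun _ hA i j hij => hA i j (by omega)

theorem mul_mem_diagonalFiltration {N k l : ℕ} {A B : Matrix (Fin N) (Fin N) K}
    (hA : A ∈ diagonalFiltration K N k) (hB : B ∈ diagonalFiltration K N l) :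
    A * B ∈ diagonalFiltration K N (k + l) := by
  intro i j hij
  rw [Matrix.mul_apply]
  refine Finset.sum_eq_zero fun p _ => ?_
  by_cases hp : (p : ℕ) < i + k
  · rw [hA i p hp, zero_mul]
  · rw [hB p j (by omega), mul_zero]

theorem lie_mem_diagonalFiltration {N k l : ℕ} {A B : Matrix (Fin N) (Fin N) K}
    (hA : A ∈ diagonalFiltration K N k) (hB : B ∈ diagonalFiltration K N l) :
    ⁅A, B⁆ ∈ diagonalFiltration K N (k + l) := by
  rw [Ring.lie_def]
  refine sub_mem (mul_mem_diagonalFiltration hA hB) ?_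
  rw [add_comm]
  exact mul_mem_diagonalFiltration hB hA

theorem eq_zero_of_mem_diagonalFiltration {N : ℕ} {A : Matrix (Fin N) (Fin N) K}
    (hA : A ∈ diagonalFiltration K N N) : A = 0 := by
  ext i j
  exact hA i j (by omega)

/-- A Lie subalgebra that contains the generators of a free Lie algebra is everything. -/
theorem FreeLieAlgebra.mem_of_forall_of_mem {X : Type*}
    (H : LieSubalgebra K (FreeLieAlgebra K X)) (h : ∀ x, FreeLieAlgebra.of K x ∈ H)
    (f : FreeLieAlgebra K X) : f ∈ H := by
  let g : FreeLieAlgebra K X →ₗ⁅K⁆ H := FreeLieAlgebra.lift K fun x => ⟨FreeLieAlgebra.of K x, h x⟩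
  have hg : H.incl.comp g = LieHom.id := by
    apply FreeLieAlgebra.hom_ext
    intro x
    simp [g]
  have := (g f).2
  rwa [show ((g f : H) : FreeLieAlgebra K X) = f from LieHom.congr_fun hg f] at this

/-- The homomorphism from a free Lie algebra, mapped to `L` by `π`, that agrees with `σ ∘ π` on the
generators, where `σ` is a linear map from `L` to matrices. -/
def liftAlong {X : Type*} {N : ℕ} (π : FreeLieAlgebra K X →ₗ⁅K⁆ L)
    (σ : L →ₗ[K] Matrix (Fin N) (Fin N) K) :
    FreeLieAlgebra K X →ₗ⁅K⁆ Matrix (Fin N) (Fin N) K :=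
  FreeLieAlgebra.lift K fun x => σ (π (FreeLieAlgebra.of K x))

/-- A linear map `σ` into strictly upper triangular matrices that respects brackets up to the
`k`-th diagonal agrees up to that diagonal with the homomorphism it induces on the free Lie
algebra. -/
theorem liftAlong_sub_mem {X : Type*} {N k : ℕ} (π : FreeLieAlgebra K X →ₗ⁅K⁆ L)
    (σ : L →ₗ[K] Matrix (Fin N) (Fin N) K) (hk : 1 ≤ k)
    (h₁ : ∀ x, σ x ∈ diagonalFiltration K N 1)
    (h₂ : ∀ x y, ⁅σ x, σ y⁆ - σ ⁅x, y⁆ ∈ diagonalFiltration K N k) (f : FreeLieAlgebra K X) :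
    liftAlong π σ f - σ (π f) ∈ diagonalFiltration K N k := by
  let ρ := liftAlong π σ
  have hstep : ∀ {A B : Matrix (Fin N) (Fin N) K}, A ∈ diagonalFiltration K N 1 →
      B ∈ diagonalFiltration K N k → ⁅A, B⁆ ∈ diagonalFiltration K N k := fun hA hB =>
    diagonalFiltration_anti (by omega) (lie_mem_diagonalFiltration hA hB)
  let H : LieSubalgebra K (FreeLieAlgebra K X) :=
    { (diagonalFiltration K N k).comap ((ρ : _ →ₗ[K] _) - σ ∘ₗ (π : _ →ₗ[K] _)) with
      lie_mem' := by
        intro f g hf hg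
        change ρ f - σ (π f) ∈ diagonalFiltration K N k at hf
        change ρ g - σ (π g) ∈ diagonalFiltration K N k at hg
        change ρ ⁅f, g⁆ - σ (π ⁅f, g⁆) ∈ diagonalFiltration K N k
        have hg' : ρ g ∈ diagonalFiltration K N 1 := by
          have := add_mem (diagonalFiltration_anti hk hg) (h₁ (π g))
          rwa [sub_add_cancel] at this
        have e : ρ ⁅f, g⁆ - σ (π ⁅f, g⁆) = -⁅ρ g, ρ f - σ (π f)⁆ + ⁅σ (π f), ρ g - σ (π g)⁆ +
            (⁅σ (π f), σ (π g)⁆ - σ ⁅π f, π g⁆) := by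
          rw [lie_skew, LieHom.map_lie, LieHom.map_lie, sub_lie, lie_sub]
          abel
        rw [e]
        exact add_mem (add_mem (neg_mem (hstep hg' hf)) (hstep (h₁ _) hg)) (h₂ _ _) }
  refine FreeLieAlgebra.mem_of_forall_of_mem H (fun x => ?_) f
  change ρ _ - σ (π _) ∈ diagonalFiltration K N k
  simp only [ρ, liftAlong, FreeLieAlgebra.lift_of_apply, sub_self]
  exact zero_mem _

section

variable {X : Type*} {N k : ℕ} (π : FreeLieAlgebra K X →ₗ⁅K⁆ L)
    (σ : L →ₗ[K] Matrix (Fin N) (Fin N) K) (hk : 1 ≤ k)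
    (h₁ : ∀ x, σ x ∈ diagonalFiltration K N 1)
    (h₂ : ∀ x y, ⁅σ x, σ y⁆ - σ ⁅x, y⁆ ∈ diagonalFiltration K N k)

include hk h₁ h₂

theorem liftAlong_mem (f : FreeLieAlgebra K X) : liftAlong π σ f ∈ diagonalFiltration K N 1 := by
  have := add_mem (diagonalFiltration_anti hk (liftAlong_sub_mem π σ hk h₁ h₂ f)) (h₁ (π f))
  rwa [sub_add_cancel] at this

/-- For matrices of size `k + 2`, the induced homomorphism kills `[[R, F], F]`: it maps `R` beyond the
`k`-th diagonal and each bracket with `F` moves one diagonal further. -/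
theorem liftAlong_eq_zero_of_mem (hN : N = k + 2) {f : FreeLieAlgebra K X}
    (hf : f ∈ LieSubmodule.lcs 2 π.ker) : liftAlong π σ f = 0 := by
  have : (LieSubmodule.lcs 2 π.ker).toSubmodule ≤ LinearMap.ker (liftAlong π σ).toLinearMap := by
    refine lcs_two_le fun x y r hr => ?_
    have hr' := liftAlong_sub_mem π σ hk h₁ h₂ r
    rw [LieHom.mem_ker] at hr
    rw [hr, map_zero, sub_zero] at hr'
    change liftAlong π σ ⁅y, ⁅x, r⁆⁆ = 0
    rw [LieHom.map_lie, LieHom.map_lie]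
    apply eq_zero_of_mem_diagonalFiltration
    have h := lie_mem_diagonalFiltration (liftAlong_mem π σ hk h₁ h₂ y)
      (lie_mem_diagonalFiltration (liftAlong_mem π σ hk h₁ h₂ x) hr')
    exact diagonalFiltration_anti (by omega) h
  exact this hf

end

/-! ### Words of length three -/

/-- The linear map to strictly upper triangular matrices whose superdiagonal entries are three given
functionals. The corner entry of the induced homomorphism reads off the coefficient of the
word `α β γ`. -/
def wordMap (α β γ : L →ₗ[K] K) : L →ₗ[K] Matrix (Fin 4) (Fin 4) K where
  toFun x := !![0, α x, 0, 0; 0, 0, β x, 0; 0, 0, 0, γ x; 0, 0, 0, 0]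
  map_add' x y := by
    ext i j; fin_cases i <;> fin_cases j <;> simp
  map_smul' c x := by
    ext i j; fin_cases i <;> fin_cases j <;> simp

theorem wordMap_mem (α β γ : L →ₗ[K] K) (x : L) :
    wordMap α β γ x ∈ diagonalFiltration K 4 1 := by
  intro i j h
  fin_cases i <;> fin_cases j <;> simp [wordMap] at h ⊢

theorem wordMap_eq_zero {α β γ : L →ₗ[K] K} {x : L} (hα : α x = 0) (hβ : β x = 0) (hγ : γ x = 0) :
    wordMap α β γ x = 0 := by
  ext i j; fin_cases i <;> fin_cases j <;> simp [wordMap, hα, hβ, hγ]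

/-- The functional on the free Lie algebra that reads off the coefficient of the word `α β γ`. -/
def wordFunctional {X : Type*} (π : FreeLieAlgebra K X →ₗ⁅K⁆ L) (α β γ : L →ₗ[K] K) :
    FreeLieAlgebra K X →ₗ[K] K :=
  Matrix.entryLinearMap K K (0 : Fin 4) (3 : Fin 4) ∘ₗ (liftAlong π (wordMap α β γ)).toLinearMap

section

variable {X : Type*} (π : FreeLieAlgebra K X →ₗ⁅K⁆ L) {α β γ : L →ₗ[K] K}
  (hα : ∀ x y : L, α ⁅x, y⁆ = 0) (hβ : ∀ x y : L, β ⁅x, y⁆ = 0) (hγ : ∀ x y : L, γ ⁅x, y⁆ = 0)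

include hα hβ hγ

theorem wordMap_lie_sub_mem (x y : L) :
    ⁅wordMap α β γ x, wordMap α β γ y⁆ - wordMap α β γ ⁅x, y⁆ ∈ diagonalFiltration K 4 2 := by
  rw [wordMap_eq_zero (hα x y) (hβ x y) (hγ x y), sub_zero]
  exact lie_mem_diagonalFiltration (wordMap_mem _ _ _ _) (wordMap_mem _ _ _ _)

theorem wordFunctional_eq_zero_of_mem {f : FreeLieAlgebra K X}
    (hf : f ∈ LieSubmodule.lcs 2 π.ker) : wordFunctional π α β γ f = 0 := by
  have := liftAlong_eq_zero_of_mem π (wordMap α β γ) one_le_two (wordMap_mem α β γ)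
    (wordMap_lie_sub_mem hα hβ hγ) rfl hf
  simp [wordFunctional, this]

/-- The coefficient of a word of length three vanishes on brackets of weight four. -/
theorem wordFunctional_lie_lie_lie (a b c e : FreeLieAlgebra K X) :
    wordFunctional π α β γ ⁅a, ⁅b, ⁅c, e⁆⁆⁆ = 0 := by
  have hm := liftAlong_mem π (wordMap α β γ) one_le_two (wordMap_mem α β γ)
    (wordMap_lie_sub_mem hα hβ hγ)
  have : liftAlong π (wordMap α β γ) ⁅a, ⁅b, ⁅c, e⁆⁆⁆ = 0 := by
    rw [LieHom.map_lie, LieHom.map_lie, LieHom.map_lie]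
    exact eq_zero_of_mem_diagonalFiltration (lie_mem_diagonalFiltration (hm a)
      (lie_mem_diagonalFiltration (hm b) (lie_mem_diagonalFiltration (hm c) (hm e))))
  simp [wordFunctional, this]

theorem wordFunctional_lie_lie (a b c : FreeLieAlgebra K X) :
    wordFunctional π α β γ ⁅⁅a, b⁆, c⁆ =
      α (π a) * β (π b) * γ (π c) - α (π b) * β (π a) * γ (π c)
        - α (π c) * β (π a) * γ (π b) + α (π c) * β (π b) * γ (π a) := by
  have hsub := liftAlong_sub_mem π (wordMap α β γ) one_le_two (wordMap_mem α β γ)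
    (wordMap_lie_sub_mem hα hβ hγ)
  have hm := liftAlong_mem π (wordMap α β γ) one_le_two (wordMap_mem α β γ)
    (wordMap_lie_sub_mem hα hβ hγ)
  have hlow : ∀ f (i j : Fin 4), (j : ℕ) < i + 1 → liftAlong π (wordMap α β γ) f i j = 0 :=
    fun f => hm f
  have hval : ∀ f (i j : Fin 4), (j : ℕ) < i + 2 →
      liftAlong π (wordMap α β γ) f i j = wordMap α β γ (π f) i j := fun f i j hij =>
    sub_eq_zero.1 (hsub f i j hij)
  have h01 : ∀ f, liftAlong π (wordMap α β γ) f 0 1 = α (π f) := fun f => hval f 0 1 (by decide)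
  have h12 : ∀ f, liftAlong π (wordMap α β γ) f 1 2 = β (π f) := fun f => hval f 1 2 (by decide)
  have h23 : ∀ f, liftAlong π (wordMap α β γ) f 2 3 = γ (π f) := fun f => hval f 2 3 (by decide)
  change liftAlong π (wordMap α β γ) ⁅⁅a, b⁆, c⁆ 0 3 = _
  rw [LieHom.map_lie, LieHom.map_lie]
  generalize liftAlong π (wordMap α β γ) = ρ at *
  simp only [Ring.lie_def, Matrix.sub_apply, Matrix.mul_apply, Fin.sum_univ_four,
    hlow _ 0 0 (by decide), hlow _ 1 0 (by decide), hlow _ 1 1 (by decide), hlow _ 2 0 (by decide),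
    hlow _ 2 1 (by decide), hlow _ 2 2 (by decide), hlow _ 3 0 (by decide), hlow _ 3 1 (by decide),
    hlow _ 3 2 (by decide), hlow _ 3 3 (by decide), h01, h12, h23]
  ring

end

/-- The word paired with a basic triple `(i, j, k)`: it is `j j i` if `j = k` and `j i k`
otherwise. -/
def BasicTriple.word {d : ℕ} (p : BasicTriple d) : Fin d × Fin d × Fin d :=
  if p.1.2.1 = p.1.2.2 then (p.1.2.1, p.1.2.1, p.1.1) else (p.1.2.1, p.1.1, p.1.2.2)

/-- The sign with which the word of a basic triple occurs in the basic commutator. -/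
def BasicTriple.sign (K : Type*) [Field K] {d : ℕ} (p : BasicTriple d) : K :=
  if p.1.2.1 = p.1.2.2 then 1 else -1

/-- The words `p.word` are dual, up to sign, to the basic commutators of weight three. -/
theorem wordFunctional_basicTriple {X : Type*} (π : FreeLieAlgebra K X →ₗ⁅K⁆ L) {d : ℕ}
    (ξ : Fin d → L →ₗ[K] K) (hξ : ∀ i, ∀ x y : L, ξ i ⁅x, y⁆ = 0) (u : Fin d → FreeLieAlgebra K X)
    (hu : ∀ i j, ξ i (π (u j)) = if i = j then 1 else 0) (p q : BasicTriple d) :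
    wordFunctional π (ξ p.word.1) (ξ p.word.2.1) (ξ p.word.2.2)
      ⁅⁅u q.1.1, u q.1.2.1⁆, u q.1.2.2⁆ = if p = q then p.sign K else 0 := by
  rw [wordFunctional_lie_lie π (hξ _) (hξ _) (hξ _)]
  have e : ∀ a b c a' b' c' : Fin d, (if a = a' then 1 else 0) * (if b = b' then 1 else 0) *
      (if c = c' then 1 else 0) = if a = a' ∧ b = b' ∧ c = c' then (1 : K) else 0 := by
    intro a b c a' b' c'
    by_cases ha : a = a' <;> by_cases hb : b = b' <;> by_cases hc : c = c' <;> simp [ha, hb, hc]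
  obtain ⟨⟨i, j, k⟩, h₁, h₂⟩ := p
  obtain ⟨⟨i', j', k'⟩, h₁', h₂'⟩ := q
  simp only [hu, e, BasicTriple.word, BasicTriple.sign, Subtype.mk.injEq, Prod.mk.injEq]
  dsimp only at h₁ h₂ h₁' h₂'
  by_cases hjk : j = k
  · rw [if_pos hjk, if_pos hjk]
    dsimp only
    rw [if_neg (by omega), if_neg (by omega), if_neg (by omega), sub_zero, sub_zero, zero_add]
    exact if_congr (by omega) rfl rfl
  · rw [if_neg hjk, if_neg hjk]
    dsimp only
    rw [if_neg (by omega), if_neg (c := j = k' ∧ i = i' ∧ k = j') (by omega),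
      if_neg (c := j = k' ∧ i = j' ∧ k = i') (by omega), sub_zero, zero_sub, add_zero]
    by_cases h : i = i' ∧ j = j' ∧ k = k'
    · rw [if_pos h, if_pos (by omega)]
    · rw [if_neg h, if_neg (by omega), neg_zero]

/-! ### Words of length four in two letters -/

section Heisenberg

variable (p q r : L →ₗ[K] K) (A B : Matrix (Fin 5) (Fin 5) K)

/-- The linear map `x ↦ p(x) A + q(x) B + r(x) [A, B]`. -/
def heisenbergMap : L →ₗ[K] Matrix (Fin 5) (Fin 5) K :=
  p.smulRight A + q.smulRight B + r.smulRight ⁅A, B⁆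

variable {p q r A B} (hA : A ∈ diagonalFiltration K 5 1) (hB : B ∈ diagonalFiltration K 5 1)
  (hp : ∀ x y : L, p ⁅x, y⁆ = 0) (hq : ∀ x y : L, q ⁅x, y⁆ = 0)
  (hr : ∀ x y : L, r ⁅x, y⁆ = p x * q y - p y * q x)

include hA hB

theorem heisenbergMap_mem (x : L) : heisenbergMap p q r A B x ∈ diagonalFiltration K 5 1 :=
  add_mem (add_mem (Submodule.smul_mem _ _ hA) (Submodule.smul_mem _ _ hB))
    (Submodule.smul_mem _ _ (diagonalFiltration_anti one_le_two (lie_mem_diagonalFiltration hA hB)))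

include hp hq hr

theorem heisenbergMap_lie_sub_mem (x y : L) :
    ⁅heisenbergMap p q r A B x, heisenbergMap p q r A B y⁆ - heisenbergMap p q r A B ⁅x, y⁆ ∈
      diagonalFiltration K 5 3 := by
  have hZ : ⁅A, B⁆ ∈ diagonalFiltration K 5 2 := lie_mem_diagonalFiltration hA hB
  have e : ⁅heisenbergMap p q r A B x, heisenbergMap p q r A B y⁆ -
      heisenbergMap p q r A B ⁅x, y⁆ =
      (p x * r y - p y * r x) • ⁅A, ⁅A, B⁆⁆ + (q x * r y - q y * r x) • ⁅B, ⁅A, B⁆⁆ := by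
    have h₁ : ⁅B, A⁆ = -⁅A, B⁆ := (lie_skew _ _).symm
    have h₂ : ⁅⁅A, B⁆, A⁆ = -⁅A, ⁅A, B⁆⁆ := (lie_skew _ _).symm
    have h₃ : ⁅⁅A, B⁆, B⁆ = -⁅B, ⁅A, B⁆⁆ := (lie_skew _ _).symm
    simp only [heisenbergMap, LinearMap.add_apply, LinearMap.smulRight_apply, hp, hq, hr]
    obtain ⟨Z, h₀⟩ : ∃ Z, ⁅A, B⁆ = Z := ⟨_, rfl⟩
    simp only [h₀] at h₁ h₂ h₃ ⊢
    simp only [add_lie, lie_add, smul_lie, lie_smul, lie_self, h₀, h₁, h₂, h₃]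
    module
  rw [e]
  exact add_mem (Submodule.smul_mem _ _ (lie_mem_diagonalFiltration hA hZ))
    (Submodule.smul_mem _ _ (lie_mem_diagonalFiltration hB hZ))

/-- On elements that map to the generators of the Heisenberg algebra, brackets of weight four are
computed in the matrices `A`, `B`: the error terms lie beyond the last diagonal. -/
theorem liftAlong_heisenbergMap_lie {X : Type*} (π : FreeLieAlgebra K X →ₗ⁅K⁆ L)
    {c₁ c₂ c₃ c₄ : FreeLieAlgebra K X} {C₁ C₂ C₃ C₄ : Matrix (Fin 5) (Fin 5) K}
    (h₁ : heisenbergMap p q r A B (π c₁) = C₁) (h₂ : heisenbergMap p q r A B (π c₂) = C₂)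
    (h₃ : heisenbergMap p q r A B (π c₃) = C₃) (h₄ : heisenbergMap p q r A B (π c₄) = C₄) :
    liftAlong π (heisenbergMap p q r A B) ⁅c₁, ⁅c₂, ⁅c₃, c₄⁆⁆⁆ = ⁅C₁, ⁅C₂, ⁅C₃, C₄⁆⁆⁆ := by
  have hsub := liftAlong_sub_mem π (heisenbergMap p q r A B) (by omega) (heisenbergMap_mem hA hB)
    (heisenbergMap_lie_sub_mem hA hB hp hq hr)
  have hm := liftAlong_mem π (heisenbergMap p q r A B) (by omega) (heisenbergMap_mem hA hB)
    (heisenbergMap_lie_sub_mem hA hB hp hq hr)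
  have hC : ∀ {c C}, heisenbergMap p q r A B (π c) = C → C ∈ diagonalFiltration K 5 1 ∧
      liftAlong π (heisenbergMap p q r A B) c - C ∈ diagonalFiltration K 5 2 := by
    rintro c _ rfl
    exact ⟨heisenbergMap_mem hA hB _, diagonalFiltration_anti (by omega) (hsub c)⟩
  -- The difference of the two sides of a bracket lies one diagonal further at each step.
  have step : ∀ {k : ℕ} {x y C D : Matrix (Fin 5) (Fin 5) K}, x ∈ diagonalFiltration K 5 1 →
      x - C ∈ diagonalFiltration K 5 2 → D ∈ diagonalFiltration K 5 k →
      y - D ∈ diagonalFiltration K 5 (k + 1) →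
      ⁅x, y⁆ - ⁅C, D⁆ ∈ diagonalFiltration K 5 (k + 1 + 1) := by
    intro k x y C D hx hxC hD hyD
    have e : ⁅x, y⁆ - ⁅C, D⁆ = ⁅x, y - D⁆ + ⁅x - C, D⁆ := by
      simp only [lie_sub, sub_lie]; abel
    rw [e]
    exact add_mem (diagonalFiltration_anti (by omega) (lie_mem_diagonalFiltration hx hyD))
      (diagonalFiltration_anti (by omega) (lie_mem_diagonalFiltration hxC hD))
  rw [LieHom.map_lie, LieHom.map_lie, LieHom.map_lie, ← sub_eq_zero]
  have d₃ := lie_mem_diagonalFiltration (hC h₃).1 (hC h₄).1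
  have d₂ := lie_mem_diagonalFiltration (hC h₂).1 d₃
  exact eq_zero_of_mem_diagonalFiltration (step (hm _) (hC h₁).2 d₂
    (diagonalFiltration_anti (by omega) (step (hm _) (hC h₂).2 d₃
      (diagonalFiltration_anti (by omega) (step (hm _) (hC h₃).2 (hC h₄).1 (hC h₄).2)))))

end Heisenberg

/-- The matrix with given superdiagonal and zeros elsewhere. -/
def superdiagonal (c : Fin 4 → K) : Matrix (Fin 5) (Fin 5) K :=
  !![0, c 0, 0, 0, 0; 0, 0, c 1, 0, 0; 0, 0, 0, c 2, 0; 0, 0, 0, 0, c 3; 0, 0, 0, 0, 0]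

theorem superdiagonal_mem (c : Fin 4 → K) : superdiagonal c ∈ diagonalFiltration K 5 1 := by
  intro i j h
  fin_cases i <;> fin_cases j <;> simp [superdiagonal] at h ⊢

/-- The terms are the eight words in the expansion of the bracket, each read along the
superdiagonal. -/
theorem superdiagonal_lie_lie_lie (a b c e : Fin 4 → K) :
    ⁅superdiagonal a, ⁅superdiagonal b, ⁅superdiagonal c, superdiagonal e⁆⁆⁆ 0 4 =
      a 0 * (b 1 * (c 2 * e 3 - e 2 * c 3) - (c 1 * e 2 - e 1 * c 2) * b 3)
        - (b 0 * (c 1 * e 2 - e 1 * c 2) - (c 0 * e 1 - e 0 * c 1) * b 2) * a 3 := by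
  simp [Ring.lie_def, superdiagonal, Matrix.sub_apply]

/-- The positions of the letter `a` in the words `aaab`, `aabb` and `abbb`. -/
def letterA (K : Type*) [Field K] : Fin 3 → Fin 4 → K :=
  ![![1, 1, 1, 0], ![1, 1, 0, 0], ![1, 0, 0, 0]]

/-- The positions of the letter `b` in the words `aaab`, `aabb` and `abbb`. -/
def letterB (K : Type*) [Field K] : Fin 3 → Fin 4 → K :=
  ![![0, 0, 0, 1], ![0, 0, 1, 1], ![0, 1, 1, 1]]

/-- A homomorphism from `L` onto the Heisenberg algebra `H(1)`, given in coordinates, with lifts of the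
two generators. -/
structure HeisenbergCoordinates (K L : Type*) [Field K] [LieRing L] [LieAlgebra K L] where
  /-- the `x`-coordinate -/
  p : L →ₗ[K] K
  /-- the `y`-coordinate -/
  q : L →ₗ[K] K
  /-- the `z`-coordinate -/
  r : L →ₗ[K] K
  p_lie : ∀ x y : L, p ⁅x, y⁆ = 0
  q_lie : ∀ x y : L, q ⁅x, y⁆ = 0
  r_lie : ∀ x y : L, r ⁅x, y⁆ = p x * q y - p y * q x
  /-- an element that maps to `x` -/
  a : L
  /-- an element that maps to `y` -/
  b : L
  p_a : p a = 1
  q_a : q a = 0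
  r_a : r a = 0
  p_b : p b = 0
  q_b : q b = 1
  r_b : r b = 0

/-- The functional on the free Lie algebra that reads off the coefficient of one of the words
`aaab`, `aabb` and `abbb`. -/
def quarticFunctional {X : Type*} (π : FreeLieAlgebra K X →ₗ⁅K⁆ L) (H : HeisenbergCoordinates K L)
    (i : Fin 3) : FreeLieAlgebra K X →ₗ[K] K :=
  Matrix.entryLinearMap K K (0 : Fin 5) (4 : Fin 5) ∘ₗ
    (liftAlong π (heisenbergMap H.p H.q H.r (superdiagonal (letterA K i))
      (superdiagonal (letterB K i)))).toLinearMap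

theorem quarticFunctional_eq_zero_of_mem {X : Type*} (π : FreeLieAlgebra K X →ₗ⁅K⁆ L)
    (H : HeisenbergCoordinates K L) (i : Fin 3) {f : FreeLieAlgebra K X}
    (hf : f ∈ LieSubmodule.lcs 2 π.ker) : quarticFunctional π H i f = 0 := by
  have := liftAlong_eq_zero_of_mem π _ (by omega : 1 ≤ 3)
    (heisenbergMap_mem (p := H.p) (q := H.q) (r := H.r) (superdiagonal_mem (letterA K i))
      (superdiagonal_mem (letterB K i)))
    (heisenbergMap_lie_sub_mem (superdiagonal_mem _) (superdiagonal_mem _) H.p_lie H.q_lie H.r_lie)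
    rfl hf
  simp [quarticFunctional, this]

/-- The three basic commutators of weight four in two letters. -/
def quarticCommutator {F : Type*} [LieRing F] (a b : F) : Fin 3 → F :=
  ![⁅a, ⁅a, ⁅a, b⁆⁆⁆, ⁅b, ⁅a, ⁅a, b⁆⁆⁆, ⁅b, ⁅b, ⁅a, b⁆⁆⁆]

/-- The words `aaab`, `aabb` and `abbb` are dual, up to sign, to the three basic commutators of
weight four in `a` and `b`. -/
theorem quarticFunctional_quarticCommutator {X : Type*} (π : FreeLieAlgebra K X →ₗ⁅K⁆ L)
    (H : HeisenbergCoordinates K L) {a b : FreeLieAlgebra K X} (ha : π a = H.a) (hb : π b = H.b)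
    (i j : Fin 3) : quarticFunctional π H i (quarticCommutator a b j) =
      if i = j then ![1, -1, 1] i else 0 := by
  let A := superdiagonal (letterA K i)
  let B := superdiagonal (letterB K i)
  have hA : heisenbergMap H.p H.q H.r A B (π a) = A := by
    simp [heisenbergMap, ha, H.p_a, H.q_a, H.r_a]
  have hB : heisenbergMap H.p H.q H.r A B (π b) = B := by
    simp [heisenbergMap, hb, H.p_b, H.q_b, H.r_b]
  have key : ∀ {c₁ c₂ c₃ c₄ : FreeLieAlgebra K X} {C₁ C₂ C₃ C₄},
      heisenbergMap H.p H.q H.r A B (π c₁) = C₁ → heisenbergMap H.p H.q H.r A B (π c₂) = C₂ →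
      heisenbergMap H.p H.q H.r A B (π c₃) = C₃ → heisenbergMap H.p H.q H.r A B (π c₄) = C₄ →
      quarticFunctional π H i ⁅c₁, ⁅c₂, ⁅c₃, c₄⁆⁆⁆ = ⁅C₁, ⁅C₂, ⁅C₃, C₄⁆⁆⁆ 0 4 := by
    intro c₁ c₂ c₃ c₄ C₁ C₂ C₃ C₄ h₁ h₂ h₃ h₄
    have := liftAlong_heisenbergMap_lie (superdiagonal_mem _) (superdiagonal_mem _) H.p_lie H.q_lie
      H.r_lie π h₁ h₂ h₃ h₄
    exact congrFun (congrFun this 0) 4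
  have e : quarticFunctional π H i (quarticCommutator a b j) =
      (![⁅A, ⁅A, ⁅A, B⁆⁆⁆ 0 4, ⁅B, ⁅A, ⁅A, B⁆⁆⁆ 0 4, ⁅B, ⁅B, ⁅A, B⁆⁆⁆ 0 4] : Fin 3 → K) j := by
    fin_cases j
    · exact key hA hA hA hB
    · exact key hB hA hA hB
    · exact key hB hB hA hB
  rw [e]
  simp only [A, B, superdiagonal_lie_lie_lie]
  fin_cases i <;> fin_cases j <;> simp [letterA, letterB]

/-- The lower bound for the multiplier of an algebra `L` of class two that maps onto the Heisenberg
algebra `H(1)`: the basic commutators of weight three in lifts of a basis of `L / L ^ 2`, and the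
basic commutators of weight four in lifts of the two generators of `H(1)`, are independent in the
multiplier. -/
theorem card_basicTriple_add_three_le {X : Type*} (π : FreeLieAlgebra K X →ₗ⁅K⁆ L)
    (hπ : Function.Surjective π) (H : HeisenbergCoordinates K L)
    (hL : LieModule.lowerCentralSeries K L L 2 = ⊥) {d : ℕ}
    (ξ : Fin d → L →ₗ[K] K) (hξ : ∀ i, ∀ x y : L, ξ i ⁅x, y⁆ = 0) (u : Fin d → FreeLieAlgebra K X)
    (hu : ∀ i j, ξ i (π (u j)) = if i = j then 1 else 0)
    [Module.Finite K (nilpotentMultiplier 2 π)] :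
    Fintype.card (BasicTriple d) + 3 ≤ Module.finrank K (nilpotentMultiplier 2 π) := by
  obtain ⟨a, ha⟩ := hπ H.a
  obtain ⟨b, hb⟩ := hπ H.b
  have hmem : ∀ x y z : FreeLieAlgebra K X, ⁅x, ⁅y, z⁆⁆ ∈ (multiplierNum 2 π).toSubmodule := by
    intro x y z
    refine ⟨?_, lie_mem_lcs_two (LieSubmodule.mem_top _) _ _⟩
    have : ⁅π x, ⁅π y, π z⁆⁆ ∈ LieModule.lowerCentralSeries K L L 2 :=
      lie_mem_lcs_two (LieSubmodule.mem_top _) _ _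
    rw [hL, LieSubmodule.mem_bot] at this
    change ⁅x, ⁅y, z⁆⁆ ∈ π.ker
    rw [LieHom.mem_ker, LieHom.map_lie, LieHom.map_lie, this]
  let E : BasicTriple d → FreeLieAlgebra K X := fun q => ⁅⁅u q.1.1, u q.1.2.1⁆, u q.1.2.2⁆
  have hE : ∀ q, E q ∈ (multiplierNum 2 π).toSubmodule := fun q => by
    change ⁅⁅u q.1.1, u q.1.2.1⁆, u q.1.2.2⁆ ∈ _
    rw [← lie_skew]
    exact neg_mem (hmem _ _ _)
  have hG : ∀ j, quarticCommutator a b j ∈ (multiplierNum 2 π).toSubmodule := fun j => by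
    fin_cases j <;> exact hmem _ _ _
  let g : BasicTriple d → FreeLieAlgebra K X →ₗ[K] K := fun p =>
    wordFunctional π (ξ p.word.1) (ξ p.word.2.1) (ξ p.word.2.2)
  let f : FreeLieAlgebra K X →ₗ[K] (BasicTriple d ⊕ Fin 3 → K) :=
    LinearMap.pi (Sum.elim g (quarticFunctional π H))
  have hgE : ∀ p q, g p (E q) = if p = q then p.sign K else 0 :=
    wordFunctional_basicTriple π ξ hξ u hu
  have hgG : ∀ p j, g p (quarticCommutator a b j) = 0 := fun p j => by
    fin_cases j <;> exact wordFunctional_lie_lie_lie π (hξ _) (hξ _) (hξ _) _ _ _ _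
  have hsign : ∀ p : BasicTriple d, p.sign K * p.sign K = 1 := fun p => by
    unfold BasicTriple.sign; split_ifs <;> simp
  have := card_le_finrank_of_functionals (P := (multiplierDen 2 π).toSubmodule)
    (Q := (multiplierNum 2 π).toSubmodule) f ?_ ?_
  · simpa using this
  · intro x hx
    ext (p | i)
    · exact wordFunctional_eq_zero_of_mem π (hξ _) (hξ _) (hξ _) hx
    · exact quarticFunctional_eq_zero_of_mem π H i hx
  · intro v
    let x : FreeLieAlgebra K X := ∑ q, (q.sign K * v (.inl q)) • E q
    let ε : Fin 3 → K := ![1, -1, 1]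
    have hε : ∀ i, ε i * ε i = 1 := fun i => by fin_cases i <;> simp [ε]
    -- The weight three part is matched first; weight four commutators do not disturb it.
    let y : FreeLieAlgebra K X :=
      ∑ j, (ε j * (v (.inr j) - quarticFunctional π H j x)) • quarticCommutator a b j
    refine ⟨x + y, add_mem (sum_mem fun q _ => Submodule.smul_mem _ _ (hE q))
      (sum_mem fun j _ => Submodule.smul_mem _ _ (hG j)), ?_⟩
    ext (p | i)
    · change g p (x + y) = _
      simp only [x, y, map_add, map_sum, map_smul, hgE, hgG, smul_eq_mul, mul_ite, mul_zero,
        Finset.sum_ite_eq, Finset.mem_univ, if_true, Finset.sum_const_zero, add_zero]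
      rw [mul_right_comm, hsign, one_mul]
    · change quarticFunctional π H i (x + y) = _
      have hy : quarticFunctional π H i y = v (.inr i) - quarticFunctional π H i x := by
        simp only [y, map_sum, map_smul, quarticFunctional_quarticCommutator π H ha hb, smul_eq_mul,
          mul_ite, mul_zero, Finset.sum_ite_eq, Finset.mem_univ, if_true]
        rw [mul_right_comm]
        exact (congrArg (· * _) (hε i)).trans (one_mul _)
      rw [map_add, hy, add_sub_cancel]

end Detection

/-! ### The upper bound -/

section UpperBound

variable {K L : Type*} [Field K] [LieRing L] [LieAlgebra K L]

theorem lie_mem_lowerCentralSeries_one (x y : L) :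
    ⁅x, y⁆ ∈ LieModule.lowerCentralSeries K L L 1 := by
  rw [LieModule.lowerCentralSeries_succ]
  exact LieSubmodule.lie_mem_lie (LieSubmodule.mem_top _) (LieSubmodule.mem_top _)

theorem lowerCentralSeries_one_le {P : Submodule K L} (h : ∀ x y : L, ⁅x, y⁆ ∈ P) :
    (LieModule.lowerCentralSeries K L L 1).toSubmodule ≤ P := by
  rw [LieModule.lowerCentralSeries_succ]
  exact lie_top_le fun x y _ => h x y

/-- A nonzero ideal of a nilpotent Lie algebra contains an ideal of codimension one with central
quotient. -/
theorem exists_hyperplane_ideal [Module.Finite K L] [LieRing.IsNilpotent L] {I : LieIdeal K L}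
    (hI : I ≠ ⊥) : ∃ I' : LieIdeal K L, ∃ z ∈ I, z ∉ I' ∧ (∀ x : L, ∀ y ∈ I, ⁅x, y⁆ ∈ I') ∧
      (∀ y ∈ I, ∃ c : K, y - c • z ∈ I') ∧ Module.finrank K I' + 1 = Module.finrank K I := by
  have hne : ¬ I ≤ ⁅(⊤ : LieIdeal K L), I⁆ := by
    intro h
    have hle : ∀ k, I ≤ LieModule.lowerCentralSeries K L L k := by
      intro k
      induction k with
      | zero => exact le_top
      | succ k ih =>
        rw [LieModule.lowerCentralSeries_succ]
        exact h.trans (LieSubmodule.mono_lie_right _ ih)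
    obtain ⟨k, hk⟩ := LieModule.IsNilpotent.nilpotent K L L
    exact hI (le_bot_iff.1 (hk ▸ hle k))
  obtain ⟨z, hz, hz'⟩ := Set.not_subset.1 hne
  obtain ⟨f, hfz, hf⟩ := Submodule.exists_le_ker_of_notMem
    (p := ⁅(⊤ : LieIdeal K L), I⁆.toSubmodule) hz'
  have hlie : ∀ x : L, ∀ y ∈ I, f ⁅x, y⁆ = 0 := fun x y hy =>
    hf (LieSubmodule.lie_mem_lie (LieSubmodule.mem_top x) hy)
  let I' : LieIdeal K L :=
    { I.toSubmodule ⊓ LinearMap.ker f with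
      lie_mem := fun {x y} hy => ⟨I.lie_mem hy.1, hlie x y hy.1⟩ }
  refine ⟨I', z, hz, fun h => hfz h.2, fun x y hy => ⟨I.lie_mem hy, hlie x y hy⟩, ?_, ?_⟩
  · intro y hy
    refine ⟨f y / f z, I.toSubmodule.sub_mem hy (I.toSubmodule.smul_mem _ hz), ?_⟩
    change f (y - (f y / f z) • z) = 0
    rw [map_sub, map_smul, smul_eq_mul, div_mul_cancel₀ _ hfz, sub_self]
  · let g : I.toSubmodule →ₗ[K] K := f.domRestrict I.toSubmodule
    have hg : Function.Surjective g := by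
      apply LinearMap.surjective
      intro h
      exact hfz (LinearMap.congr_fun h ⟨z, hz⟩)
    have h₁ := LinearMap.finrank_range_add_finrank_ker g
    rw [LinearMap.range_eq_top.2 hg, finrank_top, Module.finrank_self] at h₁
    have h₂ : (LinearMap.ker g).map I.toSubmodule.subtype = I'.toSubmodule := by
      ext y
      constructor
      · rintro ⟨⟨y, hy⟩, hy', rfl⟩
        exact ⟨hy, hy'⟩
      · rintro ⟨hy, hy'⟩
        exact ⟨⟨y, hy⟩, hy', rfl⟩
    have h₃ := (Submodule.equivMapOfInjective I.toSubmodule.subtype Subtype.val_injective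
      (LinearMap.ker g)).finrank_eq
    rw [h₂] at h₃
    change Module.finrank K I'.toSubmodule + 1 = Module.finrank K I.toSubmodule
    omega

variable {F : Type*} [LieRing F] [LieAlgebra K F]

/-- Lifts to `F` of a basis of `L / L ^ 2`, together with the dual coordinates. -/
theorem exists_lift_basis_abelianization [Module.Finite K L] (π : F →ₗ⁅K⁆ L)
    (hπ : Function.Surjective π) {d : ℕ}
    (hd : Module.finrank K (LieModule.lowerCentralSeries K L L 1) + d = Module.finrank K L) :
    ∃ (u : Fin d → F) (ξ : Fin d → L →ₗ[K] K), (∀ i, ∀ x y : L, ξ i ⁅x, y⁆ = 0) ∧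
      (∀ i j, ξ i (π (u j)) = if i = j then 1 else 0) ∧
      ∀ x, ∃ y ∈ Submodule.span K (Set.range u),
        x - y ∈ LieIdeal.comap π (LieModule.lowerCentralSeries K L L 1) := by
  set J := LieModule.lowerCentralSeries K L L 1 with hJ
  have hfin : Module.finrank K (L ⧸ J.toSubmodule) = d := by
    have := Submodule.finrank_quotient_add_finrank J.toSubmodule
    change Module.finrank K J.toSubmodule + d = _ at hd
    omega
  let b := Module.finBasisOfFinrankEq K (L ⧸ J.toSubmodule) hfin
  have hs : Function.Surjective (J.toSubmodule.mkQ ∘ π) := (Submodule.mkQ_surjective _).comp hπ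
  choose u hu using fun i => hs (b i)
  have hu' : ∀ i, J.toSubmodule.mkQ (π (u i)) = b i := hu
  refine ⟨u, fun i => b.coord i ∘ₗ J.toSubmodule.mkQ, ?_, ?_, ?_⟩
  · intro i x y
    have : J.toSubmodule.mkQ ⁅x, y⁆ = 0 :=
      (Submodule.Quotient.mk_eq_zero _).2 (lie_mem_lowerCentralSeries_one x y)
    rw [LinearMap.comp_apply, this, map_zero]
  · intro i j
    rw [LinearMap.comp_apply, hu', Module.Basis.coord_apply, Module.Basis.repr_self,
      Finsupp.single_apply]
    exact if_congr eq_comm rfl rfl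
  · intro x
    refine ⟨∑ i, b.repr (J.toSubmodule.mkQ (π x)) i • u i,
      sum_mem fun i _ => Submodule.smul_mem _ _ (Submodule.subset_span ⟨i, rfl⟩), ?_⟩
    rw [LieIdeal.mem_comap, map_sub, ← LieSubmodule.mem_toSubmodule,
      ← Submodule.Quotient.mk_eq_zero]
    change J.toSubmodule.mkQ (π x - π _) = 0
    rw [map_sub, map_sum, map_sum]
    simp only [map_smul, hu']
    rw [b.sum_repr, sub_self]

/-- A nilpotent Lie algebra that is not abelian is not perfect. -/
theorem finrank_lowerCentralSeries_one_lt [Module.Finite K L] [LieRing.IsNilpotent L]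
    (h : 1 ≤ Module.finrank K (LieModule.lowerCentralSeries K L L 1)) :
    Module.finrank K (LieModule.lowerCentralSeries K L L 1) < Module.finrank K L := by
  apply Submodule.finrank_lt (s := (LieModule.lowerCentralSeries K L L 1).toSubmodule)
  intro htop
  have hpos : 0 < Module.finrank K L :=
    h.trans (Submodule.finrank_le (LieModule.lowerCentralSeries K L L 1).toSubmodule)
  have hne : (⊤ : LieIdeal K L) ≠ ⊥ := by
    intro hbot
    have h₁ : (⊤ : Submodule K L) = ⊥ := congrArg LieSubmodule.toSubmodule hbot
    have h₂ := congrArg (fun S : Submodule K L => Module.finrank K S) h₁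
    simp only [finrank_top, finrank_bot] at h₂
    omega
  obtain ⟨I', z, -, hz, hlie, -, -⟩ := exists_hyperplane_ideal hne
  have hle := lowerCentralSeries_one_le (P := I'.toSubmodule)
    fun x y => hlie x y (LieSubmodule.mem_top y)
  rw [htop] at hle
  exact hz (hle Submodule.mem_top)

/-- Climbing from the kernel of `π` to the preimage of an ideal `I` of `L` one dimension at a time
enlarges `[[R, F], F]` by at most `d ^ 2` dimensions at each step. -/
theorem generatedMod_lcs_two_comap [Module.Finite K L] [LieRing.IsNilpotent L] (π : F →ₗ⁅K⁆ L)
    (hπ : Function.Surjective π) {d : ℕ} (u : Fin d → F)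
    (hu : ∀ x, ∃ y ∈ Submodule.span K (Set.range u),
      x - y ∈ LieIdeal.comap π (LieModule.lowerCentralSeries K L L 1))
    (j : ℕ) (I : LieIdeal K L) (hI : Module.finrank K I = j) :
    GeneratedMod (j * (d * d)) (LieSubmodule.lcs 2 π.ker).toSubmodule
      (LieSubmodule.lcs 2 (I.comap π)).toSubmodule := by
  induction j generalizing I with
  | zero =>
    have hbot : I.toSubmodule = ⊥ := Submodule.finrank_eq_zero.1 hI
    have hbot' : I.comap π = π.ker := by
      ext x
      rw [LieIdeal.mem_comap, LieHom.mem_ker, ← LieSubmodule.mem_toSubmodule, hbot,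
        Submodule.mem_bot]
    rw [hbot']
    exact GeneratedMod.of_le le_rfl
  | succ j ih =>
    have hne : I ≠ ⊥ := by
      rintro rfl
      have : Module.finrank K (⊥ : Submodule K L) = j + 1 := hI
      rw [finrank_bot] at this
      omega
    obtain ⟨I', z, hz, -, hlie, hspan, hrank⟩ := exists_hyperplane_ideal hne
    obtain ⟨s, rfl⟩ := hπ z
    have hstep := generatedMod_lcs_two_of_insert (R' := I'.comap π) (R := I.comap π) s
      (fun r hr => by
        obtain ⟨c, hc⟩ := hspan (π r) (LieIdeal.mem_comap.1 hr)
        refine ⟨c, ?_⟩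
        rw [LieIdeal.mem_comap, map_sub, map_smul]
        exact hc)
      (fun x => by
        rw [LieIdeal.mem_comap, LieHom.map_lie]
        exact hlie _ _ hz) u 
      (W := (LieIdeal.comap π (LieModule.lowerCentralSeries K L L 1)).toSubmodule)
      (fun x hx => by
        have hle : (LieModule.lowerCentralSeries K L L 1).toSubmodule ≤
            ⁅(⊤ : LieIdeal K F), (⊤ : LieIdeal K F)⁆.toSubmodule.map π.toLinearMap := by
          refine lowerCentralSeries_one_le fun x y => ?_
          obtain ⟨x, rfl⟩ := hπ x
          obtain ⟨y, rfl⟩ := hπ y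
          exact ⟨⁅x, y⁆, LieSubmodule.lie_mem_lie (LieSubmodule.mem_top _) (LieSubmodule.mem_top _),
            π.map_lie x y⟩
        obtain ⟨y, hy, hyx⟩ := hle (LieIdeal.mem_comap.1 hx)
        have hxy : x - y ∈ I'.comap π := by
          have : π y = π x := hyx
          rw [LieIdeal.mem_comap, map_sub, this, sub_self]
          exact zero_mem _
        rw [← sub_add_cancel x y]
        exact Submodule.add_mem_sup hxy hy) hu
    refine ((ih I' (by omega)).trans hstep).mono (le_of_eq ?_) le_rfl
    ring

/-- The upper bound for an arbitrary presentation: the three summands count generators of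
`F ^ 3` modulo `[[S, F], F]`, of `[[S, F], F]` modulo `[[R', F], F]`, and of `[[R', F], F]` modulo
`[[R, F], F]`, where `S` is the preimage of `L ^ 2` and `R'` is the preimage of a hyperplane in
`L ^ 2` that contains `L ^ 3`. -/
theorem generatedMod_lowerCentralSeries [Module.Finite K L] [LieRing.IsNilpotent L] (π : F →ₗ⁅K⁆ L)
    (hπ : Function.Surjective π) {d k : ℕ}
    (hd : Module.finrank K (LieModule.lowerCentralSeries K L L 1) + d = Module.finrank K L)
    (hk : Module.finrank K (LieModule.lowerCentralSeries K L L 1) = k + 1) :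
    GeneratedMod (Fintype.card (BasicTriple d) + (3 + k * (d * d)))
      (LieSubmodule.lcs 2 π.ker).toSubmodule
      (LieModule.lowerCentralSeries K F F 2).toSubmodule := by
  obtain ⟨u, ξ, -, -, hu⟩ := exists_lift_basis_abelianization π hπ hd
  have hne : LieModule.lowerCentralSeries K L L 1 ≠ ⊥ := by
    intro h
    have : Module.finrank K (⊥ : Submodule K L) = k + 1 := by
      rw [← hk, h]; rfl
    rw [finrank_bot] at this
    omega
  obtain ⟨I', z, hz, hzI, hlie, hspan, hrank⟩ := exists_hyperplane_ideal hne
  obtain ⟨a, b, hab⟩ : ∃ a b : L, ⁅a, b⁆ ∉ I' := by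
    by_contra! h
    exact hzI (lowerCentralSeries_one_le (P := I'.toSubmodule) h hz)
  obtain ⟨a, rfl⟩ := hπ a
  obtain ⟨b, rfl⟩ := hπ b
  have hline := generatedMod_lcs_two_of_line (R := I'.comap π)
    (S := LieIdeal.comap π (LieModule.lowerCentralSeries K L L 1)) (a := a) (b := b) (fun x hx => by
      obtain ⟨c, hc⟩ := hspan (π x) (LieIdeal.mem_comap.1 hx)
      obtain ⟨t, ht⟩ := hspan ⁅π a, π b⁆ (lie_mem_lowerCentralSeries_one _ _)
      have ht0 : t ≠ 0 := by
        rintro rfl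
        exact hab (by simpa using ht)
      refine ⟨c / t, ?_⟩
      rw [LieIdeal.mem_comap, map_sub, map_smul, LieHom.map_lie]
      have e : π x - (c / t) • ⁅π a, π b⁆ =
          (π x - c • z) - (c / t) • (⁅π a, π b⁆ - t • z) := by
        rw [smul_sub, smul_smul, div_mul_cancel₀ _ ht0]; abel
      rw [e]
      exact sub_mem hc (SMulMemClass.smul_mem _ ht))
    (fun x y => by
      rw [LieIdeal.mem_comap, LieHom.map_lie]
      exact lie_mem_lowerCentralSeries_one _ _)
  have h₁ := generatedMod_lcs_two_comap π hπ u hu k I' (by omega)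
  exact (h₁.trans hline).trans (generatedMod_lowerCentralSeries_two u hu)

/-- If `L ^ 2` is a line and the alternating form on `L` induced by the bracket has rank at least
four, the multiplier is not larger than that of the abelian algebra `L / L ^ 2`. -/
theorem generatedMod_lowerCentralSeries_of_commute [Module.Finite K L] (π : F →ₗ⁅K⁆ L)
    (hπ : Function.Surjective π) {d : ℕ}
    (hd : Module.finrank K (LieModule.lowerCentralSeries K L L 1) + d = Module.finrank K L)
    (hk : Module.finrank K (LieModule.lowerCentralSeries K L L 1) = 1)
    {a b c e : L} (hab : ⁅a, b⁆ ≠ 0) (hac : ⁅a, c⁆ = 0) (hbc : ⁅b, c⁆ = 0) (hae : ⁅a, e⁆ = 0)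
    (hbe : ⁅b, e⁆ = 0) (hce : ⁅c, e⁆ ≠ 0) :
    GeneratedMod (Fintype.card (BasicTriple d)) (LieSubmodule.lcs 2 π.ker).toSubmodule
      (LieModule.lowerCentralSeries K F F 2).toSubmodule := by
  obtain ⟨u, ξ, -, -, hu⟩ := exists_lift_basis_abelianization π hπ hd
  obtain ⟨a, rfl⟩ := hπ a
  obtain ⟨b, rfl⟩ := hπ b
  obtain ⟨c, rfl⟩ := hπ c
  obtain ⟨e, rfl⟩ := hπ e
  have hmem : ∀ {x y : F}, ⁅π x, π y⁆ = 0 → ⁅x, y⁆ ∈ π.ker := fun {x y} h => by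
    rw [LieHom.mem_ker, LieHom.map_lie, h]
  have hle := lcs_two_le_of_line_of_commute (R := π.ker)
    (S := LieIdeal.comap π (LieModule.lowerCentralSeries K L L 1)) (a := a) (b := b) (c := c) (e := e)
    (fun x hx => by
      have h0 : (⟨⁅π a, π b⁆, lie_mem_lowerCentralSeries_one _ _⟩ :
          LieModule.lowerCentralSeries K L L 1) ≠ 0 := fun h => hab (congrArg Subtype.val h)
      obtain ⟨t, ht⟩ := (finrank_eq_one_iff_of_nonzero' _ h0).1 hk ⟨π x, LieIdeal.mem_comap.1 hx⟩
      refine ⟨t, ?_⟩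
      rw [LieHom.mem_ker, map_sub, map_smul, LieHom.map_lie, sub_eq_zero]
      exact (congrArg Subtype.val ht).symm)
    (fun x y => by
      rw [LieIdeal.mem_comap, LieHom.map_lie]
      exact lie_mem_lowerCentralSeries_one _ _)
    (hmem hac) (hmem hbc) (hmem hae) (hmem hbe)
    (fun h => hce (by rwa [LieHom.mem_ker, LieHom.map_lie] at h))
  exact (GeneratedMod.of_le (k := 0) hle).trans (generatedMod_lowerCentralSeries_two u hu)

end UpperBound

/-! ### Nilpotent Lie algebras with one-dimensional derived algebra -/

section Classification

variable {K L : Type*} [Field K] [LieRing L] [LieAlgebra K L]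

theorem HeisenbergLie.lie_eq (x y : HeisenbergLie K 1) :
    ⁅x, y⁆ = ((0, 0, x.1 0 * y.2.1 0 - y.1 0 * x.2.1 0) : (Fin 1 → K) × (Fin 1 → K) × K) := by
  change ((0, 0, x.1 ⬝ᵥ y.2.1 - y.1 ⬝ᵥ x.2.1) : (Fin 1 → K) × (Fin 1 → K) × K) = _
  simp [dotProduct]

/-- If `L ^ 2` is a line spanned by `[a, b]`, then either the common centralizer of `a` and `b` is
not abelian, or it is a central complement up to `[a, b]` and `L ≅ H(1) ⊕ A(n - 3)`. -/
theorem nonempty_equiv_or_exists_commute [Module.Finite K L] [LieRing.IsNilpotent L]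
    (hk : Module.finrank K (LieModule.lowerCentralSeries K L L 1) = 1) :
    Nonempty (L ≃ₗ⁅K⁆ HeisenbergLie K 1 × AbelianLie K (Module.finrank K L - 3)) ∨
      ∃ a b c e : L, ⁅a, b⁆ ≠ 0 ∧ ⁅a, c⁆ = 0 ∧ ⁅b, c⁆ = 0 ∧ ⁅a, e⁆ = 0 ∧ ⁅b, e⁆ = 0 ∧
        ⁅c, e⁆ ≠ 0 := by
  have hne : LieModule.lowerCentralSeries K L L 1 ≠ ⊥ := by
    intro h
    have : Module.finrank K (⊥ : Submodule K L) = 1 := by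
      rw [← hk, h]; rfl
    rw [finrank_bot] at this
    omega
  obtain ⟨I', z₀, hz, hzI, hlie, hspan, hrank⟩ := exists_hyperplane_ideal hne
  have hbot : ∀ x ∈ I', x = 0 := by
    have h : I'.toSubmodule = ⊥ := Submodule.finrank_eq_zero.1
      (by change Module.finrank K I' = 0; omega)
    intro x hx
    rwa [← LieSubmodule.mem_toSubmodule, h, Submodule.mem_bot] at hx
  obtain ⟨a, b, hab⟩ : ∃ a b : L, ⁅a, b⁆ ≠ 0 := by
    by_contra! h
    exact hzI (lowerCentralSeries_one_le (P := I'.toSubmodule)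
      (fun x y => by rw [h]; exact zero_mem _) hz)
  by_cases hC : ∃ c e : L, ⁅a, c⁆ = 0 ∧ ⁅b, c⁆ = 0 ∧ ⁅a, e⁆ = 0 ∧ ⁅b, e⁆ = 0 ∧ ⁅c, e⁆ ≠ 0
  · obtain ⟨c, e, h⟩ := hC
    exact .inr ⟨a, b, c, e, hab, h⟩
  push Not at hC
  left
  set z := ⁅a, b⁆ with hz
  have hcent : ∀ x : L, ⁅x, z⁆ = 0 := fun x =>
    hbot _ (hlie x z (lie_mem_lowerCentralSeries_one a b))
  have hcent' : ∀ x : L, ⁅z, x⁆ = 0 := fun x => by rw [← lie_skew, hcent, neg_zero]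
  obtain ⟨ρ₁, hρ₁⟩ := Submodule.exists_le_ker_of_notMem (p := (⊥ : Submodule K L)) (v := z)
    (by simpa using hab)
  -- `ρ₀` is a functional with `ρ₀ z = 1`; it computes the coefficient of `z` in a bracket.
  let ρ₀ : L →ₗ[K] K := (ρ₁ z)⁻¹ • ρ₁
  have hρz : ρ₀ z = 1 := inv_mul_cancel₀ hρ₁.1
  have hbr : ∀ x y : L, ⁅x, y⁆ = ρ₀ ⁅x, y⁆ • z := by
    intro x y
    have h0 : (⟨z, lie_mem_lowerCentralSeries_one _ _⟩ :
        LieModule.lowerCentralSeries K L L 1) ≠ 0 := fun h => hab (congrArg Subtype.val h)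
    obtain ⟨t, ht⟩ := (finrank_eq_one_iff_of_nonzero' _ h0).1 hk
      ⟨⁅x, y⁆, lie_mem_lowerCentralSeries_one _ _⟩
    have ht' : t • z = ⁅x, y⁆ := congrArg Subtype.val ht
    rw [← ht', map_smul, hρz, smul_eq_mul, mul_one]
  let p : L →ₗ[K] K := -(ρ₀ ∘ₗ LieAlgebra.ad K L b)
  let q : L →ₗ[K] K := ρ₀ ∘ₗ LieAlgebra.ad K L a
  let r : L →ₗ[K] K := ρ₀ - ρ₀ a • p - ρ₀ b • q
  have hp : ∀ x, p x = ρ₀ ⁅x, b⁆ := fun x => by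
    change -ρ₀ ⁅b, x⁆ = _
    rw [← map_neg, lie_skew]
  have hq : ∀ x, q x = ρ₀ ⁅a, x⁆ := fun x => rfl
  have hr : ∀ x, r x = ρ₀ x - ρ₀ a * p x - ρ₀ b * q x := fun x => rfl
  have hpa : p a = 1 := by rw [hp, ← hz, hρz]
  have hqa : q a = 0 := by rw [hq, lie_self, map_zero]
  have hpb : p b = 0 := by rw [hp, lie_self, map_zero]
  have hqb : q b = 1 := by rw [hq, ← hz, hρz]
  have hpz : p z = 0 := by rw [hp, hcent', map_zero]
  have hqz : q z = 0 := by rw [hq, hcent, map_zero]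
  have hra : r a = 0 := by rw [hr, hpa, hqa]; ring
  have hrb : r b = 0 := by rw [hr, hpb, hqb]; ring
  have hrz : r z = 1 := by rw [hr, hpz, hqz, hρz]; ring
  let Φ : L →ₗ[K] K × K × K := p.prod (q.prod r)
  have hΦ : Function.Surjective Φ := by
    rintro ⟨s, t, w⟩
    refine ⟨s • a + t • b + w • z, ?_⟩
    simp [Φ, hpa, hqa, hpb, hqb, hpz, hqz, hra, hrb, hrz]
  have hdim := LinearMap.finrank_range_add_finrank_ker Φ
  rw [LinearMap.range_eq_top.2 hΦ, finrank_top, Module.finrank_prod, Module.finrank_prod,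
    Module.finrank_self] at hdim
  let κ : (Fin (Module.finrank K L - 3) → K) ≃ₗ[K] LinearMap.ker Φ :=
    LinearEquiv.ofFinrankEq _ _ (by rw [Module.finrank_fin_fun]; omega)
  have hker : ∀ w : LinearMap.ker Φ, p w = 0 ∧ q w = 0 ∧ r w = 0 := fun w => by
    have h : (p w, q w, r w) = 0 := w.2
    exact ⟨congrArg (·.1) h, congrArg (·.2.1) h, congrArg (·.2.2) h⟩
  have hca : ∀ w : LinearMap.ker Φ, ⁅a, (w : L)⁆ = 0 := fun w => by
    rw [hbr, ← hq, (hker w).2.1, zero_smul]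
  have hcb : ∀ w : LinearMap.ker Φ, ⁅b, (w : L)⁆ = 0 := fun w => by
    rw [← lie_skew, hbr, ← hp, (hker w).1, zero_smul, neg_zero]
  have hcc : ∀ w w' : LinearMap.ker Φ, ⁅(w : L), (w' : L)⁆ = 0 := fun w w' =>
    hC _ _ (hca w) (hcb w) (hca w') (hcb w')
  have hca' : ∀ w : LinearMap.ker Φ, ⁅(w : L), a⁆ = 0 := fun w => by rw [← lie_skew, hca, neg_zero]
  have hcb' : ∀ w : LinearMap.ker Φ, ⁅(w : L), b⁆ = 0 := fun w => by rw [← lie_skew, hcb, neg_zero]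
  let g : (HeisenbergLie K 1 × AbelianLie K (Module.finrank K L - 3)) →ₗ⁅K⁆ L :=
    { toFun x := x.1.1 0 • a + x.1.2.1 0 • b + x.1.2.2 • z + (κ x.2 : L)
      map_add' x y := by
        have h : κ (x + y).2 = κ x.2 + κ y.2 := κ.map_add x.2 y.2
        change (x.1.1 0 + y.1.1 0) • a + (x.1.2.1 0 + y.1.2.1 0) • b + (x.1.2.2 + y.1.2.2) • z +
          ((κ (x + y).2 : LinearMap.ker Φ) : L) = _
        rw [h, Submodule.coe_add]
        module
      map_smul' c x := by
        have h : κ (c • x).2 = c • κ x.2 := κ.map_smul c x.2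
        change (c * x.1.1 0) • a + (c * x.1.2.1 0) • b + (c * x.1.2.2) • z +
          ((κ (c • x).2 : LinearMap.ker Φ) : L) = c • _
        rw [h, Submodule.coe_smul]
        module
      map_lie' := by
        intro x y
        have h : κ ⁅x, y⁆.2 = 0 := κ.map_zero
        have h' : ⁅x, y⁆.1 = ⁅x.1, y.1⁆ := rfl
        change ⁅x, y⁆.1.1 0 • a + ⁅x, y⁆.1.2.1 0 • b + ⁅x, y⁆.1.2.2 • z +
          ((κ ⁅x, y⁆.2 : LinearMap.ker Φ) : L) = ⁅_, _⁆
        rw [h, h', HeisenbergLie.lie_eq]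
        have hba : ⁅b, a⁆ = -z := by rw [hz, lie_skew]
        simp only [add_lie, lie_add, smul_lie, lie_smul, lie_self, hcent, hcent', hca, hcb, hcc,
          hca', hcb', hba, ← hz, Pi.zero_apply, Submodule.coe_zero]
        module }
  have hg : ∀ x, g x = x.1.1 0 • a + x.1.2.1 0 • b + x.1.2.2 • z + (κ x.2 : L) := fun _ => rfl
  refine ⟨(LieEquiv.ofBijective g ⟨?_, ?_⟩).symm⟩
  · rw [← LieHom.coe_toLinearMap, ← LinearMap.ker_eq_bot, LinearMap.ker_eq_bot']
    rintro ⟨⟨s, t, w⟩, y⟩ h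
    replace h : s 0 • a + t 0 • b + w • z + (κ y : L) = 0 := h
    have h₁ := congrArg p h
    have h₂ := congrArg q h
    have h₃ := congrArg r h
    simp [hpa, hpb, hpz, hqa, hqb, hqz, hra, hrb, hrz, hker (κ y)] at h₁ h₂ h₃
    rw [h₁, h₂, h₃] at h
    have hy : y = 0 := (LinearEquiv.map_eq_zero_iff κ).1 (by simpa using h)
    have hs : s = 0 := by ext i; fin_cases i; exact h₁
    have ht : t = 0 := by ext i; fin_cases i; exact h₂
    subst hs ht h₃ hy
    rfl
  · intro x
    have hmem : x - p x • a - q x • b - r x • z ∈ LinearMap.ker Φ := by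
      rw [LinearMap.mem_ker]
      simp [Φ, hpa, hqa, hpb, hqb, hpz, hqz, hra, hrb, hrz]
    refine ⟨((fun _ => p x, fun _ => q x, r x), κ.symm ⟨_, hmem⟩), ?_⟩
    change p x • a + q x • b + r x • z + ((κ (κ.symm ⟨_, hmem⟩) : LinearMap.ker Φ) : L) = x
    rw [κ.apply_symm_apply]
    module

/-- The coordinates of the first factor of `H(1) ⊕ A(k)`. -/
def HeisenbergCoordinates.ofEquiv {k : ℕ} (e : L ≃ₗ⁅K⁆ HeisenbergLie K 1 × AbelianLie K k) :
    HeisenbergCoordinates K L where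
  p := LinearMap.proj 0 ∘ₗ LinearMap.fst K (Fin 1 → K) ((Fin 1 → K) × K) ∘ₗ
    LinearMap.fst K (HeisenbergLie K 1) (AbelianLie K k) ∘ₗ e.toLinearEquiv.toLinearMap
  q := LinearMap.proj 0 ∘ₗ LinearMap.fst K (Fin 1 → K) K ∘ₗ
    LinearMap.snd K (Fin 1 → K) ((Fin 1 → K) × K) ∘ₗ
    LinearMap.fst K (HeisenbergLie K 1) (AbelianLie K k) ∘ₗ e.toLinearEquiv.toLinearMap
  r := LinearMap.snd K (Fin 1 → K) K ∘ₗ LinearMap.snd K (Fin 1 → K) ((Fin 1 → K) × K) ∘ₗ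
    LinearMap.fst K (HeisenbergLie K 1) (AbelianLie K k) ∘ₗ e.toLinearEquiv.toLinearMap
  p_lie x y := by
    change (e ⁅x, y⁆).1.1 0 = 0
    rw [LieEquiv.map_lie]
    rfl
  q_lie x y := by
    change (e ⁅x, y⁆).1.2.1 0 = 0
    rw [LieEquiv.map_lie]
    rfl
  r_lie x y := by
    change (e ⁅x, y⁆).1.2.2 = (e x).1.1 0 * (e y).1.2.1 0 - (e y).1.1 0 * (e x).1.2.1 0
    rw [LieEquiv.map_lie, LieAlgebra.Prod.bracket_apply, HeisenbergLie.lie_eq]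
  a := e.symm ((1, 0, 0), 0)
  b := e.symm ((0, 1, 0), 0)
  p_a := by
    change (e (e.symm _)).1.1 0 = 1
    rw [LieEquiv.apply_symm_apply]; rfl
  q_a := by
    change (e (e.symm _)).1.2.1 0 = 0
    rw [LieEquiv.apply_symm_apply]; rfl
  r_a := by
    change (e (e.symm _)).1.2.2 = 0
    rw [LieEquiv.apply_symm_apply]
  p_b := by
    change (e (e.symm _)).1.1 0 = 0
    rw [LieEquiv.apply_symm_apply]; rfl
  q_b := by
    change (e (e.symm _)).1.2.1 0 = 1
    rw [LieEquiv.apply_symm_apply]; rfl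
  r_b := by
    change (e (e.symm _)).1.2.2 = 0
    rw [LieEquiv.apply_symm_apply]

/-- In `H(1) ⊕ A(k)` the derived algebra is at most a line, and it is central. -/
theorem lowerCentralSeries_of_equiv {k : ℕ} (e : L ≃ₗ⁅K⁆ HeisenbergLie K 1 × AbelianLie K k) :
    Module.finrank K (LieModule.lowerCentralSeries K L L 1) ≤ 1 ∧
      LieModule.lowerCentralSeries K L L 2 = ⊥ := by
  let z : HeisenbergLie K 1 × AbelianLie K k := ((0, 0, 1), 0)
  have hbr : ∀ x y : L, ∃ t : K, ⁅x, y⁆ = t • e.symm z := by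
    intro x y
    refine ⟨(e x).1.1 0 * (e y).1.2.1 0 - (e y).1.1 0 * (e x).1.2.1 0, ?_⟩
    apply e.toLinearEquiv.injective
    change e _ = e _
    rw [LieEquiv.map_lie, LieAlgebra.Prod.bracket_apply, HeisenbergLie.lie_eq]
    have h : ∀ t : K, e (t • e.symm z) = t • z := fun t =>
      (e.toLinearEquiv.map_smul t _).trans (congrArg (t • ·) (e.apply_symm_apply z))
    rw [h]
    refine Prod.ext (Prod.ext ?_ (Prod.ext ?_ ?_)) ?_
    · exact (smul_zero _).symm
    · exact (smul_zero _).symm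
    · exact (mul_one _).symm
    · exact (smul_zero _).symm
  have hz : ∀ x : L, ⁅x, e.symm z⁆ = 0 := by
    intro x
    apply e.toLinearEquiv.injective
    change e _ = e _
    rw [LieEquiv.map_lie, LieEquiv.apply_symm_apply, LieAlgebra.Prod.bracket_apply,
      HeisenbergLie.lie_eq]
    have h0 : e 0 = 0 := e.toLinearEquiv.map_zero
    rw [h0]
    refine Prod.ext (Prod.ext rfl (Prod.ext rfl ?_)) rfl
    change (e x).1.1 0 * 0 - 0 * (e x).1.2.1 0 = 0
    ring
  constructor
  · have hle : (LieModule.lowerCentralSeries K L L 1).toSubmodule ≤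
        Submodule.span K {e.symm z} := lowerCentralSeries_one_le fun x y => by
      obtain ⟨t, ht⟩ := hbr x y
      rw [ht]
      exact Submodule.smul_mem _ _ (Submodule.mem_span_singleton_self _)
    calc Module.finrank K (LieModule.lowerCentralSeries K L L 1).toSubmodule
        ≤ Module.finrank K (Submodule.span K {e.symm z}) := Submodule.finrank_mono hle
      _ ≤ 1 := (finrank_span_le_card _).trans (by simp)
  · rw [eq_bot_iff]
    refine (lcs_two_le (R := (⊤ : LieIdeal K L)) (P := ⊥) fun x y r _ => ?_ :
      (LieModule.lowerCentralSeries K L L 2).toSubmodule ≤ ⊥)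
    obtain ⟨t, ht⟩ := hbr x r
    rw [ht, lie_smul, hz, smul_zero]
    exact zero_mem _

end Classification

end

/-! ### The bound and the equality case -/

theorem mainTheorem2 {K : Type*} [Field K]
    {L : Type*} [LieRing L] [LieAlgebra K L] [Module.Finite K L] [LieRing.IsNilpotent L]
    (n m : ℕ) (hn : Module.finrank K L = n)
    (hm : Module.finrank K (LieModule.lowerCentralSeries K L L 1) = m) (hm1 : 1 ≤ m)
    {X : Type*} (π : FreeLieAlgebra K X →ₗ⁅K⁆ L) (hπ : Function.Surjective π) :
    Module.Finite K (nilpotentMultiplier 2 π) ∧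
    (Module.finrank K (nilpotentMultiplier 2 π) : ℚ) ≤
      1 / 3 * ((n : ℚ) - m) * (((n : ℚ) + 2 * m - 2) * ((n : ℚ) - m - 1) + 3 * ((m : ℚ) - 1)) + 3 ∧
    (Module.finrank K (nilpotentMultiplier 2 π) : ℚ) ≤
      1 / 3 * (n : ℚ) * ((n : ℚ) - 1) * ((n : ℚ) - 2) + 3 ∧
    ((Module.finrank K (nilpotentMultiplier 2 π) : ℚ) =
        1 / 3 * (n : ℚ) * ((n : ℚ) - 1) * ((n : ℚ) - 2) + 3 ↔
      Nonempty (L ≃ₗ⁅K⁆ HeisenbergLie K 1 × AbelianLie K (n - 3))) := by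
  have hlt := finrank_lowerCentralSeries_one_lt (K := K) (L := L) (by omega)
  obtain ⟨k, rfl⟩ : ∃ k, m = k + 1 := ⟨m - 1, by omega⟩
  obtain ⟨d, rfl⟩ : ∃ d, n = k + 1 + d := ⟨n - (k + 1), by omega⟩
  have hd1 : 1 ≤ d := by omega
  have hd : Module.finrank K (LieModule.lowerCentralSeries K L L 1) + d = Module.finrank K L := by
    omega
  have hle : multiplierNum 2 π ≤ LieModule.lowerCentralSeries K _ _ 2 := inf_le_right
  obtain ⟨hfin, hub⟩ := ((generatedMod_lowerCentralSeries π hπ hd hm).mono le_rfl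
    (Q' := (multiplierNum 2 π).toSubmodule) hle).finite_and_finrank_le
  change Module.Finite K (nilpotentMultiplier 2 π) at hfin
  change Module.finrank K (nilpotentMultiplier 2 π) ≤ _ at hub
  set D := Module.finrank K (nilpotentMultiplier 2 π) with hD
  have hC : (Fintype.card (BasicTriple d) : ℚ) = ((d : ℚ) ^ 3 - d) / 3 := by
    have := three_mul_card_basicTriple d
    have h : 3 * (Fintype.card (BasicTriple d) : ℚ) = (d : ℚ) ^ 3 - d := by exact_mod_cast this
    linarith
  have hub' : (D : ℚ) ≤ ((d : ℚ) ^ 3 - d) / 3 + (3 + k * (d * d)) := by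
    rw [← hC]
    exact_mod_cast hub
  -- The second bound exceeds the first by `d k ^ 2 + (k ^ 3 - k) / 3`, where `k = m - 1`.
  have hk3 : (k : ℚ) ≤ (k : ℚ) ^ 3 := by
    exact_mod_cast Nat.le_self_pow (by norm_num) k
  have hdk : (0 : ℚ) ≤ d * (k : ℚ) ^ 2 := by positivity
  have e₁ : 1 / 3 * (((k + 1 + d : ℕ) : ℚ) - (k + 1 : ℕ)) *
      ((((k + 1 + d : ℕ) : ℚ) + 2 * (k + 1 : ℕ) - 2) * (((k + 1 + d : ℕ) : ℚ) - (k + 1 : ℕ) - 1) +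
        3 * (((k + 1 : ℕ) : ℚ) - 1)) + 3 = ((d : ℚ) ^ 3 - d) / 3 + (3 + k * (d * d)) := by
    push_cast; ring
  have e₂ : 1 / 3 * ((k + 1 + d : ℕ) : ℚ) * (((k + 1 + d : ℕ) : ℚ) - 1) *
      (((k + 1 + d : ℕ) : ℚ) - 2) + 3 = ((d : ℚ) ^ 3 - d) / 3 + (3 + k * (d * d)) +
        (d * (k : ℚ) ^ 2 + ((k : ℚ) ^ 3 - k) / 3) := by
    push_cast; ring
  rw [e₁, e₂]
  refine ⟨hfin, hub', by linarith, ?_, ?_⟩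
  · intro heq
    have hk : k = 0 := by
      by_contra hk
      have : (0 : ℚ) < d * (k : ℚ) ^ 2 := by positivity
      linarith
    subst hk
    rcases nonempty_equiv_or_exists_commute (K := K) (L := L) hm with h | h
    · rwa [hn] at h
    · obtain ⟨a, b, c, e, hab, hac, hbc, hae, hbe, hce⟩ := h
      have h := ((generatedMod_lowerCentralSeries_of_commute π hπ hd hm hab hac hbc hae hbe
        hce).mono le_rfl (Q' := (multiplierNum 2 π).toSubmodule) hle).finite_and_finrank_le.2
      change D ≤ _ at h
      have h' : (D : ℚ) ≤ ((d : ℚ) ^ 3 - d) / 3 := by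
        rw [← hC]
        exact_mod_cast h
      rw [heq] at h'
      norm_num at h'
  · rintro ⟨e⟩
    obtain ⟨h₁, h₂⟩ := lowerCentralSeries_of_equiv e
    obtain rfl : k = 0 := by omega
    obtain ⟨u, ξ, hξ, hu, -⟩ := exists_lift_basis_abelianization π hπ hd
    have hlb := card_basicTriple_add_three_le π hπ (HeisenbergCoordinates.ofEquiv e) h₂ ξ hξ u hu
    have hlb' : ((d : ℚ) ^ 3 - d) / 3 + 3 ≤ D := by
      rw [← hC]
      exact_mod_cast hlb
    apply le_antisymm
    · linarith
    · norm_num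
      linarith
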